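/- **Setting.** A $\dagger$-SMC is a symmetric monoidal category $(\mathbf C,\otimes,I,\sigma)$ with an identity-on-objects, involutive, contravariant functor $(-)^\dagger$ such that $(f\otimes g)^\dagger=f^\dagger\otimes g^\dagger$ and the structural isomorphisms are unitary (in the strict case: $\sigma_{A,B}^\dagger=\sigma_{B,A}$). A $\dagger$-CC is a $\dagger$-SMC in which each object $A$ has a chosen dual $A^*$ with $\mathrm{cup}_A:A\otimes A^*\to I$ and $\mathrm{cap}_A:I\to A^*\otimes A$ satisfying the snake equations and $\mathrm{cup}_A^\dagger=\sigma\circ\mathrm{cap}_A$. A morphism $u$ is an *isometry* if $u^\dagger\circ u=1$. Structural isomorphisms (associators, unitors) are suppressed below. For $f:A\to B\otimes X$ and $g:A\to B\otimes Y$ in $\mathbf C$: * $f\sim_{\rm iso} g$ if there are isometries $u:X\to Z$, $v:Y\to Z$ with $(1_B\otimes u)\circ f=(1_B\otimes v)\circ g$; $\sim_{\rm iso}^{+}$ is the transitive closure of $\sim_{\rm iso}$ (on pairs of an object $X$ and a morphism $A\to B\otimes X$, for fixed $A,B$). * $f\sim_{\rm CP} g$ if $(1_B\otimes f^\dagger)\circ(1_B\otimes\sigma_{X,B})\circ(f\otimes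 1_B)=(1_B\otimes g^\dagger)\circ(1_B\otimes\sigma_{Y,B})\circ(g\otimes 1_B)$ as morphisms $A\otimes B\to B\otimes A$. $\mathbf C$ *has enough isometries* if $\sim_{\rm CP}$ and $\sim_{\rm iso}^{+}$ are equal. The symmetric monoidal category $\mathbf C^{\mathrm{disc}}$ has the objects of $\mathbf C$; its morphisms are the formal composites and tensor products of morphisms of $\mathbf C$ and of new generators $\mathrm{disc}_A:A\to I$ (one for each object), modulo the congruence generated by the axioms of symmetric monoidal categories, the equations of $\mathbf C$ (so that there is an identity-on-objects strict symmetric monoidal functor $\iota:\mathbf C\to\mathbf C^{\mathrm{disc}}$), and $\mathrm{disc}_B\circ\iota(u)=\mathrm{disc}_A$ for each isometry $u:A\to B$, $\mathrm{disc}_I=1_I$, $\mathrm{disc}_{A\otimes B}=\mathrm{disc}_A\otimes\mathrm{disc}_B$. An *environment structure* for $\mathbf C$ is a symmetric monoidal category $\overline{\mathbf C}$ (compact closed if $\mathbf C$ is) with the same objects, an identity-on-objects strict symmetric monoidal functor $\iota:\mathbf C\to\overline{\mathbf C}$, and morphisms $\mathrm{disc}_A:A\to I$ of $\overline{\mathbf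 C}$ such that (1) $\mathrm{disc}_I=1_I$ and $\mathrm{disc}_{A\otimes B}=\mathrm{disc}_A\otimes\mathrm{disc}_B$; (2) every $f:A\to B$ of $\overline{\mathbf C}$ equals $(1_B\otimes\mathrm{disc}_X)\circ\iota(f')$ for some $f':A\to B\otimes X$ in $\mathbf C$; (3) for all $f:A\to B\otimes X$, $g:A\to B\otimes Y$ in $\mathbf C$: $f\sim_{\rm CP}g$ if and only if $(1_B\otimes\mathrm{disc}_X)\circ\iota(f)=(1_B\otimes\mathrm{disc}_Y)\circ\iota(g)$. If $\mathbf C$ is a $\dagger$-CC, let $f_*:A^*\to B^*$ be the dual of $f^\dagger$, for $f:A\to B$. Then $\mathrm{CPM}(\mathbf C)$ is the symmetric monoidal category with the objects of $\mathbf C$, whose morphisms $A\to B$ are those morphisms $A\otimes A^*\to B\otimes B^*$ of $\mathbf C$ which arise from $f\otimes f_*$ for some $f:A\to B\otimes X$ by joining the wires $X$ and $X^*$ by $\mathrm{cup}_X$ (using $(B\otimes X)^*\cong B^*\otimes X^*$), with the composition of $\mathbf C$ and the tensor product induced from $\mathbf C$. It comes with the functor $\mathbf C\to\mathrm{CPM}(\mathbf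 C)$, $f\mapsto f\otimes f_*$, and with the discard maps $A\to I$ given by $\mathrm{cup}_A$. **Lemma.** Let $\mathbf C$ be a $\dagger$-SMC. Then $\mathbf C$ has enough isometries if and only if $\mathbf C^{\mathrm{disc}}$, with $\iota$ and the discard maps $\mathrm{disc}_A$, is an environment structure for $\mathbf C$. If moreover $\mathbf C$ is a $\dagger$-CC, so that $\mathrm{CPM}(\mathbf C)$ is defined, then the following are equivalent: 1. $\mathbf C$ has enough isometries; 2. $\mathbf C^{\mathrm{disc}}$ is an environment structure for $\mathbf C$; 3. $\mathbf C^{\mathrm{disc}}\simeq\mathrm{CPM}(\mathbf C)$ as extensions of $\mathbf C$ with discard maps: there is an equivalence of symmetric monoidal categories $\mathbf C^{\mathrm{disc}}\simeq\mathrm{CPM}(\mathbf C)$ which commutes, up to a monoidal natural isomorphism, with the functors from $\mathbf C$, and which preserves the discard maps. -/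

import Mathlib

open CategoryTheory MonoidalCategory

set_option linter.unusedSectionVars false

universe v u v' u' v'' u''

namespace Discarding

/-- A dagger symmetric monoidal category: an identity-on-objects involutive contravariant functor
which is compatible with the tensor product and for which the structural isomorphisms are
unitary. -/
class DaggerSMC (C : Type u) [Category.{v} C] [MonoidalCategory C] [SymmetricCategory C] where
  dagger : ∀ {X Y : C}, (X ⟶ Y) → (Y ⟶ X)
  dagger_dagger : ∀ {X Y : C} (f : X ⟶ Y), dagger (dagger f) = f
  dagger_id : ∀ X : C, dagger (𝟙 X) = 𝟙 X
  dagger_comp : ∀ {X Y Z : C} (f : X ⟶ Y) (g : Y ⟶ Z), dagger (f ≫ g) = dagger g ≫ dagger f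
  dagger_tensor : ∀ {X Y X' Y' : C} (f : X ⟶ Y) (g : X' ⟶ Y'),
    dagger (f ⊗ₘ g) = dagger f ⊗ₘ dagger g
  dagger_associator : ∀ X Y Z : C, dagger (α_ X Y Z).hom = (α_ X Y Z).inv
  dagger_leftUnitor : ∀ X : C, dagger (λ_ X).hom = (λ_ X).inv
  dagger_rightUnitor : ∀ X : C, dagger (ρ_ X).hom = (ρ_ X).inv
  dagger_braiding : ∀ X Y : C, dagger (β_ X Y).hom = (β_ Y X).hom

postfix:max "†" => DaggerSMC.dagger

section Relations

variable {C : Type u} [Category.{v} C] [MonoidalCategory C] [SymmetricCategory C] [DaggerSMC C]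

/-- `f : X ⟶ Y` is an isometry if `f† ∘ f = 1`. -/
def IsIsometry {X Y : C} (f : X ⟶ Y) : Prop := f ≫ f† = 𝟙 X

/-- A morphism `A ⟶ B ⊗ X` of `C`, together with the object `X` that is to be discarded. -/
structure Purification (A B : C) where
  env : C
  map : A ⟶ B ⊗ env

/-- `f ∼_iso g`: there are isometries `u`, `v` out of the two environments into a common object
with `(1 ⊗ u) ∘ f = (1 ⊗ v) ∘ g`. -/
def IsoRel {A B : C} (p q : Purification A B) : Prop :=
  ∃ (Z : C) (u : p.env ⟶ Z) (v : q.env ⟶ Z), IsIsometry u ∧ IsIsometry v ∧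
    p.map ≫ B ◁ u = q.map ≫ B ◁ v

/-- For `f : A ⟶ B ⊗ X`, the morphism `A ⊗ B ⟶ B ⊗ A` obtained by plugging the `X`-output of `f`
into the `X`-input of `f† : B ⊗ X ⟶ A`, leaving both `B`-wires open. -/
def Purification.plug {A B : C} (p : Purification A B) : A ⊗ B ⟶ B ⊗ A :=
  p.map ▷ B ≫ (α_ B p.env B).hom ≫ B ◁ (β_ p.env B).hom ≫ B ◁ p.map†

/-- `f ∼_CP g`: the morphisms obtained from `f` and `g` by joining each of them with its dagger
along the environment coincide. -/
def CPRel {A B : C} (p q : Purification A B) : Prop := p.plug = q.plug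

variable (C) in
/-- `C` has enough isometries: `∼_CP` is the transitive closure of `∼_iso`. -/
def EnoughIsometries : Prop :=
  ∀ (A B : C) (p q : Purification A B), CPRel p q ↔ Relation.TransGen IsoRel p q

end Relations

/-! ### The discard construction -/

section Discard

variable (C : Type u) [Category.{v} C] [MonoidalCategory C] [SymmetricCategory C] [DaggerSMC C]

/-- Objects of the category `C^⏚`: the same as those of `C`. -/
structure DiscardCat where
  obj : C

variable {C}

/-- Formal composites and tensor products of morphisms of `C` and discard maps. -/
inductive Diagram : C → C → Type (max u v)
  | of {X Y : C} (f : X ⟶ Y) : Diagram X Y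
  | disc (X : C) : Diagram X (𝟙_ C)
  | comp {X Y Z : C} (s : Diagram X Y) (t : Diagram Y Z) : Diagram X Z
  | tensor {X Y X' Y' : C} (s : Diagram X Y) (t : Diagram X' Y') : Diagram (X ⊗ X') (Y ⊗ Y')

/-- The congruence on formal composites generated by the equations of symmetric monoidal categories,
the equations of `C`, and the equations which turn the unit object into a terminal object over the
isometries: discarding is natural for isometries, compatible with tensor products, and trivial on
the unit object. -/
inductive Diagram.Rel : ∀ {X Y : C}, Diagram X Y → Diagram X Y → Prop
  | refl {X Y : C} (s : Diagram X Y) : Rel s s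
  | symm {X Y : C} {s t : Diagram X Y} : Rel s t → Rel t s
  | trans {X Y : C} {r s t : Diagram X Y} : Rel r s → Rel s t → Rel r t
  | comp_congr {X Y Z : C} {s s' : Diagram X Y} {t t' : Diagram Y Z} :
      Rel s s' → Rel t t' → Rel (.comp s t) (.comp s' t')
  | tensor_congr {X Y X' Y' : C} {s s' : Diagram X Y} {t t' : Diagram X' Y'} :
      Rel s s' → Rel t t' → Rel (.tensor s t) (.tensor s' t')
  | id_comp {X Y : C} (s : Diagram X Y) : Rel (.comp (.of (𝟙 X)) s) s
  | comp_id {X Y : C} (s : Diagram X Y) : Rel (.comp s (.of (𝟙 Y))) s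
  | assoc {W X Y Z : C} (r : Diagram W X) (s : Diagram X Y) (t : Diagram Y Z) :
      Rel (.comp (.comp r s) t) (.comp r (.comp s t))
  | tensor_comp {X Y Z X' Y' Z' : C} (s : Diagram X Y) (t : Diagram Y Z)
      (s' : Diagram X' Y') (t' : Diagram Y' Z') :
      Rel (.comp (.tensor s s') (.tensor t t')) (.tensor (.comp s t) (.comp s' t'))
  | associator_naturality {X Y X' Y' X'' Y'' : C} (s : Diagram X Y) (s' : Diagram X' Y')
      (s'' : Diagram X'' Y'') :
      Rel (.comp (.tensor (.tensor s s') s'') (.of (α_ Y Y' Y'').hom))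
        (.comp (.of (α_ X X' X'').hom) (.tensor s (.tensor s' s'')))
  | leftUnitor_naturality {X Y : C} (s : Diagram X Y) :
      Rel (.comp (.tensor (.of (𝟙 (𝟙_ C))) s) (.of (λ_ Y).hom)) (.comp (.of (λ_ X).hom) s)
  | rightUnitor_naturality {X Y : C} (s : Diagram X Y) :
      Rel (.comp (.tensor s (.of (𝟙 (𝟙_ C)))) (.of (ρ_ Y).hom)) (.comp (.of (ρ_ X).hom) s)
  | braiding_naturality {X Y X' Y' : C} (s : Diagram X Y) (s' : Diagram X' Y') :
      Rel (.comp (.tensor s s') (.of (β_ Y Y').hom)) (.comp (.of (β_ X X').hom) (.tensor s' s))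
  | of_comp {X Y Z : C} (f : X ⟶ Y) (g : Y ⟶ Z) : Rel (.of (f ≫ g)) (.comp (.of f) (.of g))
  | of_tensor {X Y X' Y' : C} (f : X ⟶ Y) (g : X' ⟶ Y') :
      Rel (.of (f ⊗ₘ g)) (.tensor (.of f) (.of g))
  | disc_isometry {X Y : C} (u : X ⟶ Y) (hu : IsIsometry u) :
      Rel (.comp (.of u) (.disc Y)) (.disc X)
  | disc_unit : Rel (.disc (𝟙_ C)) (.of (𝟙 (𝟙_ C)))
  | disc_tensor (X Y : C) :
      Rel (.disc (X ⊗ Y)) (.comp (.tensor (.disc X) (.disc Y)) (.of (λ_ (𝟙_ C)).hom))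

/-- The setoid of provably equal diagrams. -/
instance Diagram.setoid (X Y : C) : Setoid (Diagram X Y) where
  r := Diagram.Rel
  iseqv := ⟨Diagram.Rel.refl, Diagram.Rel.symm, Diagram.Rel.trans⟩

namespace DiscardCat

instance : Category.{max u v} (DiscardCat C) where
  Hom X Y := Quotient (Diagram.setoid X.obj Y.obj)
  id X := ⟦.of (𝟙 X.obj)⟧
  comp f g := Quotient.map₂ Diagram.comp (fun _ _ h _ _ h' => .comp_congr h h') f g
  id_comp f := by
    induction f using Quotient.inductionOn
    exact Quotient.sound (.id_comp _)
  comp_id f := by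
    induction f using Quotient.inductionOn
    exact Quotient.sound (.comp_id _)
  assoc f g h := by
    induction f using Quotient.inductionOn
    induction g using Quotient.inductionOn
    induction h using Quotient.inductionOn
    exact Quotient.sound (.assoc _ _ _)

/-- The morphism of `C^⏚` represented by a diagram. -/
def homMk {X Y : C} (s : Diagram X Y) : (mk X : DiscardCat C) ⟶ mk Y := Quotient.mk _ s

theorem homMk_eq {X Y : C} {s t : Diagram X Y} (h : s.Rel t) : homMk s = homMk t :=
  Quotient.sound h

theorem homMk_surjective {X Y : DiscardCat C} (f : X ⟶ Y) :
    ∃ s : Diagram X.obj Y.obj, homMk s = f := Quotient.exists_rep f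

theorem homMk_comp {X Y Z : C} (s : Diagram X Y) (t : Diagram Y Z) :
    homMk (.comp s t) = homMk s ≫ homMk t := rfl

variable (C) in
/-- The functor `ι : C ⥤ C^⏚`. -/
def incl : C ⥤ DiscardCat C where
  obj X := ⟨X⟩
  map f := homMk (.of f)
  map_id _ := rfl
  map_comp f g := homMk_eq (.of_comp f g)

/-- Tensor product of morphisms of `C^⏚`. -/
def tensorHom {X Y X' Y' : DiscardCat C} (f : X ⟶ Y) (g : X' ⟶ Y') :
    (mk (X.obj ⊗ X'.obj) : DiscardCat C) ⟶ mk (Y.obj ⊗ Y'.obj) :=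
  Quotient.map₂ Diagram.tensor (fun _ _ h _ _ h' => .tensor_congr h h') f g

instance : MonoidalCategoryStruct (DiscardCat C) where
  tensorObj X Y := ⟨X.obj ⊗ Y.obj⟩
  tensorUnit := ⟨𝟙_ C⟩
  tensorHom f g := tensorHom f g
  whiskerLeft X _ _ f := tensorHom (𝟙 X) f
  whiskerRight f Y := tensorHom f (𝟙 Y)
  associator X Y Z := (incl C).mapIso (α_ X.obj Y.obj Z.obj)
  leftUnitor X := (incl C).mapIso (λ_ X.obj)
  rightUnitor X := (incl C).mapIso (ρ_ X.obj)

theorem homMk_tensor {X Y X' Y' : C} (s : Diagram X Y) (t : Diagram X' Y') :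
    homMk (.tensor s t) = homMk s ⊗ₘ homMk t := rfl

theorem map_tensor {X Y X' Y' : C} (f : X ⟶ Y) (g : X' ⟶ Y') :
    (incl C).map (f ⊗ₘ g) = (incl C).map f ⊗ₘ (incl C).map g :=
  homMk_eq (.of_tensor f g)

instance : MonoidalCategory (DiscardCat C) :=
  MonoidalCategory.ofTensorHom
    (id_tensorHom_id := fun X Y => by
      refine (map_tensor (𝟙 X.obj) (𝟙 Y.obj)).symm.trans ?_
      rw [id_tensorHom_id]; rfl)
    (id_tensorHom := fun _ _ _ _ => rfl)
    (tensorHom_id := fun _ _ => rfl)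
    (tensorHom_comp_tensorHom := fun f₁ f₂ g₁ g₂ => by
      obtain ⟨_, rfl⟩ := homMk_surjective f₁
      obtain ⟨_, rfl⟩ := homMk_surjective f₂
      obtain ⟨_, rfl⟩ := homMk_surjective g₁
      obtain ⟨_, rfl⟩ := homMk_surjective g₂
      exact homMk_eq (.tensor_comp _ _ _ _))
    (associator_naturality := fun f₁ f₂ f₃ => by
      obtain ⟨_, rfl⟩ := homMk_surjective f₁
      obtain ⟨_, rfl⟩ := homMk_surjective f₂
      obtain ⟨_, rfl⟩ := homMk_surjective f₃
      exact homMk_eq (.associator_naturality _ _ _))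
    (leftUnitor_naturality := fun f => by
      obtain ⟨_, rfl⟩ := homMk_surjective f
      exact homMk_eq (.leftUnitor_naturality _))
    (rightUnitor_naturality := fun f => by
      obtain ⟨_, rfl⟩ := homMk_surjective f
      exact homMk_eq (.rightUnitor_naturality _))
    (pentagon := fun W X Y Z => by
      have h := congrArg (incl C).map (pentagon W.obj X.obj Y.obj Z.obj)
      simp only [← MonoidalCategory.tensorHom_id, ← MonoidalCategory.id_tensorHom,
        Functor.map_comp, map_tensor] at h
      exact h)
    (triangle := fun X Y => by
      have h := congrArg (incl C).map (triangle X.obj Y.obj)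
      simp only [← MonoidalCategory.tensorHom_id, ← MonoidalCategory.id_tensorHom,
        Functor.map_comp, map_tensor] at h
      exact h)

theorem map_whiskerLeft (X : C) {Y Z : C} (f : Y ⟶ Z) :
    (incl C).map (X ◁ f) = (incl C).obj X ◁ (incl C).map f := by
  rw [← MonoidalCategory.id_tensorHom, map_tensor]; rfl

theorem map_whiskerRight {Y Z : C} (f : Y ⟶ Z) (X : C) :
    (incl C).map (f ▷ X) = (incl C).map f ▷ (incl C).obj X := by
  rw [← MonoidalCategory.tensorHom_id, map_tensor]; rfl

instance : (incl C).Monoidal :=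
  Functor.CoreMonoidal.toMonoidal
    { εIso := Iso.refl _
      μIso := fun _ _ => Iso.refl _
      μIso_hom_natural_left := fun f X => by
        rw [map_whiskerRight]; exact (Category.comp_id _).trans (Category.id_comp _).symm
      μIso_hom_natural_right := fun X f => by
        rw [map_whiskerLeft]; exact (Category.comp_id _).trans (Category.id_comp _).symm
      associativity := fun X Y Z => by
        simp only [Iso.refl_hom]
        erw [id_whiskerRight, whiskerLeft_id, Category.id_comp, Category.id_comp, Category.comp_id,
          Category.comp_id]
        rfl
      left_unitality := fun X => by
        simp only [Iso.refl_hom]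
        erw [id_whiskerRight, Category.id_comp, Category.id_comp]
        rfl
      right_unitality := fun X => by
        simp only [Iso.refl_hom]
        erw [whiskerLeft_id, Category.id_comp, Category.id_comp]
        rfl }

theorem braiding_natural {X Y X' Y' : DiscardCat C} (f : X ⟶ Y) (g : X' ⟶ Y') :
    (f ⊗ₘ g) ≫ (incl C).map (β_ Y.obj Y'.obj).hom =
      (incl C).map (β_ X.obj X'.obj).hom ≫ (g ⊗ₘ f) := by
  obtain ⟨_, rfl⟩ := homMk_surjective f
  obtain ⟨_, rfl⟩ := homMk_surjective g
  exact homMk_eq (.braiding_naturality _ _)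

instance : SymmetricCategory (DiscardCat C) where
  braiding X Y := (incl C).mapIso (β_ X.obj Y.obj)
  braiding_naturality_right X _ _ f := braiding_natural (𝟙 X) f
  braiding_naturality_left f Z := braiding_natural f (𝟙 Z)
  hexagon_forward X Y Z := by
    have h := congrArg (incl C).map (BraidedCategory.hexagon_forward X.obj Y.obj Z.obj)
    simp only [Functor.map_comp, map_whiskerLeft, map_whiskerRight] at h
    exact h
  hexagon_reverse X Y Z := by
    have h := congrArg (incl C).map (BraidedCategory.hexagon_reverse X.obj Y.obj Z.obj)
    simp only [Functor.map_comp, map_whiskerLeft, map_whiskerRight] at h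
    exact h
  symmetry X Y := by
    have h := congrArg (incl C).map (SymmetricCategory.symmetry X.obj Y.obj)
    rw [Functor.map_comp] at h
    exact h.trans ((incl C).map_id _)

instance : (incl C).Braided where
  braided _ _ := (Category.id_comp _).trans (Category.comp_id _).symm

variable (C) in
/-- The discard maps of `C^⏚`. -/
def disc (X : C) : (incl C).obj X ⟶ 𝟙_ (DiscardCat C) := homMk (.disc X)

end DiscardCat

end Discard

/-! ### Environment structures -/

section Environment

/-- A symmetric monoidal category is compact closed if each object has a dual. -/
def IsCompactClosed (D : Type u) [Category.{v} D] [MonoidalCategory D] [SymmetricCategory D] :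
    Prop :=
  ∀ X : D, ∃ X' : D, Nonempty (ExactPairing X' X)

variable {C : Type u} [Category.{v} C] [MonoidalCategory C] [SymmetricCategory C]
  {D : Type u'} [Category.{v'} D] [MonoidalCategory D] [SymmetricCategory D]

open Functor.LaxMonoidal Functor.OplaxMonoidal

/-- A symmetric monoidal functor is strict and identity-on-objects (up to the identification of the
objects of `C` with those of `D`): it is bijective on objects, it preserves unit and tensor
products of objects on the nose, and its structure morphisms are the resulting identities. -/
structure IsIdentityOnObjects (ι : C ⥤ D) [ι.Braided] : Prop where
  bijective : Function.Bijective ι.obj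
  unit : ∃ h : 𝟙_ D = ι.obj (𝟙_ C), ε ι = eqToHom h
  tensor : ∀ X Y : C, ∃ h : ι.obj X ⊗ ι.obj Y = ι.obj (X ⊗ Y), μ ι X Y = eqToHom h

/-- Given discard maps in `D`, discard the second factor of `B ⊗ X`. -/
def discardSnd (ι : C ⥤ D) [ι.Braided] (disc : ∀ X : C, ι.obj X ⟶ 𝟙_ D) (B X : C) :
    ι.obj (B ⊗ X) ⟶ ι.obj B :=
  δ ι B X ≫ ι.obj B ◁ disc X ≫ (ρ_ (ι.obj B)).hom

/-- `D`, with the functor `ι : C ⥤ D` and the discard maps `disc`, is an environment structure for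
the dagger symmetric monoidal category `C`. -/
structure IsEnvironmentStructure [DaggerSMC C] (ι : C ⥤ D) [ι.Braided]
    (disc : ∀ X : C, ι.obj X ⟶ 𝟙_ D) : Prop where
  compact : IsCompactClosed C → IsCompactClosed D
  identityOnObjects : IsIdentityOnObjects ι
  disc_unit : disc (𝟙_ C) = η ι
  disc_tensor : ∀ A B : C, disc (A ⊗ B) = δ ι A B ≫ (disc A ⊗ₘ disc B) ≫ (λ_ (𝟙_ D)).hom
  purification : ∀ {A B : C} (f : ι.obj A ⟶ ι.obj B), ∃ p : Purification A B,
    f = ι.map p.map ≫ discardSnd ι disc B p.env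
  uniqueness : ∀ {A B : C} (p q : Purification A B), CPRel p q ↔
    ι.map p.map ≫ discardSnd ι disc B p.env = ι.map q.map ≫ discardSnd ι disc B q.env

end Environment

/-! ### Dagger compact categories and the CPM construction -/

section Compact

/-- A dagger compact category: each object `A` has a dual `A*` with a cap `1 ⟶ A* ⊗ A` and a cup
`A ⊗ A* ⟶ 1` satisfying the snake equations, such that the dagger of the cup is the cap followed by
the symmetry. -/
class DaggerCompact (C : Type u) [Category.{v} C] [MonoidalCategory C] [SymmetricCategory C]
    [DaggerSMC C] where
  dual : C → C
  pairing : ∀ A : C, ExactPairing (dual A) A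
  dagger_cup : ∀ A : C, (pairing A).evaluation'† = (pairing A).coevaluation' ≫ (β_ (dual A) A).hom

variable {C : Type u} [Category.{v} C] [MonoidalCategory C] [SymmetricCategory C] [DaggerSMC C]
  [DaggerCompact C]

open DaggerCompact (dual)

instance (A : C) : ExactPairing (dual A) A := DaggerCompact.pairing A

/-- The cup `A ⊗ A* ⟶ 1`. -/
def cup (A : C) : A ⊗ dual A ⟶ 𝟙_ C := ε_ (dual A) A

/-- The conjugate `f_* : A* ⟶ B*` of `f : A ⟶ B`, i.e. the dual of `f† : B ⟶ A`. -/
def conj {A B : C} (f : A ⟶ B) : dual A ⟶ dual B :=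
  @leftAdjointMate C _ _ B A ⟨dual B⟩ ⟨dual A⟩ (f†)

theorem conj_cup {A B : C} (f : A ⟶ B) : B ◁ conj f ≫ cup B = f† ▷ dual A ≫ cup A :=
  @leftAdjointMate_comp_evaluation C _ _ B A ⟨dual B⟩ ⟨dual A⟩ (f†)

theorem cup_cancel {Z B : C} {g h : Z ⟶ dual B} (w : B ◁ g ≫ cup B = B ◁ h ≫ cup B) : g = h := by
  have key : ∀ k : Z ⟶ dual B, k = (λ_ Z).inv ≫ η_ (dual B) B ▷ Z ≫ (α_ _ _ _).hom ≫
      dual B ◁ (B ◁ k ≫ cup B) ≫ (ρ_ _).hom := by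
    intro k
    have h1 : dual B ◁ B ◁ k = (α_ (dual B) B Z).inv ≫ (dual B ⊗ B) ◁ k ≫ (α_ (dual B) B (dual B)).hom := by simp
    rw [whiskerLeft_comp, h1]
    simp only [Category.assoc, Iso.hom_inv_id_assoc]
    rw [← whisker_exchange_assoc]
    have := ExactPairing.evaluation_coevaluation_assoc (dual B) B (ρ_ (dual B)).hom
    rw [cup, this]
    simp
  rw [key g, key h, w]

theorem conj_id (A : C) : conj (𝟙 A) = 𝟙 (dual A) := by
  rw [conj, DaggerSMC.dagger_id]
  exact @leftAdjointMate_id C _ _ A ⟨dual A⟩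

theorem conj_comp {X Y Z : C} (f : X ⟶ Y) (g : Y ⟶ Z) : conj (f ≫ g) = conj f ≫ conj g := by
  rw [conj, DaggerSMC.dagger_comp]
  exact @comp_leftAdjointMate C _ _ Z Y X ⟨dual Z⟩ ⟨dual Y⟩ ⟨dual X⟩ _ _

/-- The pairing `(A ⊗ B) ⊗ (A* ⊗ B*) ⟶ 1` given by the two cups. -/
def cup₂ (A B : C) : (A ⊗ B) ⊗ (dual A ⊗ dual B) ⟶ 𝟙_ C :=
  tensorμ A B (dual A) (dual B) ≫ (cup A ⊗ₘ cup B) ≫ (λ_ (𝟙_ C)).hom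

theorem slide {A' B B' : C} (c : B ⊗ B' ⟶ 𝟙_ C) :
    B ◁ (β_ A' B').hom ≫ (α_ _ _ _).inv ≫ c ▷ A' ≫ (λ_ A').hom =
      (α_ _ _ _).inv ≫ (β_ B A').hom ▷ B' ≫ (α_ _ _ _).hom ≫ A' ◁ c ≫ (ρ_ A').hom := by
  have h := BraidedCategory.braiding_naturality_right A' c
  rw [← braiding_leftUnitor A', reassoc_of% h, BraidedCategory.braiding_tensor_right_hom]
  simp only [Category.assoc, Iso.hom_inv_id_assoc, ← comp_whiskerRight_assoc,
    SymmetricCategory.symmetry, id_whiskerRight, Category.id_comp, Iso.inv_hom_id_assoc]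

theorem cup₂_eq (A B : C) : cup₂ A B =
    (A ⊗ B) ◁ (β_ (dual A) (dual B)).hom ≫ ε_ (dual B ⊗ dual A) (A ⊗ B) := by
  rw [ExactPairing.tensor_evaluation, cup₂, tensorμ]
  calc _ = 𝟙 _ ⊗≫ A ◁ ((α_ _ _ _).inv ≫ (β_ B (dual A)).hom ▷ (dual B) ≫ (α_ _ _ _).hom ≫
              dual A ◁ cup B ≫ (ρ_ _).hom) ⊗≫ cup A ⊗≫ 𝟙 _ := by
          rw [tensorHom_def']; monoidal
    _ = _ := by rw [← slide, cup, cup]; monoidal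

/-- The isomorphism `A* ⊗ B* ≅ (A ⊗ B)*`. -/
def dualTensor (A B : C) : dual A ⊗ dual B ≅ dual (A ⊗ B) :=
  leftDualIso (exactPairingCongrLeft (Y := A ⊗ B) (β_ (dual A) (dual B)))
    (DaggerCompact.pairing (A ⊗ B))

theorem dualTensor_cup (A B : C) : (A ⊗ B) ◁ (dualTensor A B).hom ≫ cup (A ⊗ B) = cup₂ A B := by
  have h := @leftAdjointMate_comp_evaluation C _ _ (A ⊗ B) (A ⊗ B) ⟨dual (A ⊗ B)⟩
    (@HasLeftDual.mk _ _ _ _ (dual A ⊗ dual B)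
      (exactPairingCongrLeft (Y := A ⊗ B) (β_ (dual A) (dual B))))
    (𝟙 _)
  rw [cup₂_eq]
  refine h.trans ?_
  rw [id_whiskerRight, Category.id_comp]
  rfl

/-- The isomorphism `1 ≅ 1*`. -/
def dualUnit : 𝟙_ C ≅ dual (𝟙_ C) :=
  leftDualIso exactPairingUnit (DaggerCompact.pairing (𝟙_ C))

theorem dualUnit_cup : (𝟙_ C) ◁ (dualUnit (C := C)).hom ≫ cup (𝟙_ C) = (ρ_ (𝟙_ C)).hom := by
  have h := @leftAdjointMate_comp_evaluation C _ _ (𝟙_ C) (𝟙_ C) ⟨dual (𝟙_ C)⟩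
    ⟨𝟙_ C⟩ (𝟙 _)
  refine h.trans ?_
  rw [id_whiskerRight, Category.id_comp]
  rfl

variable (C) in
/-- Conjugation as a functor. -/
def conjFunctor : C ⥤ C where
  obj A := dual A
  map f := conj f
  map_id := conj_id
  map_comp := conj_comp

theorem dualTensor_natural {A A' B B' : C} (f : A ⟶ A') (g : B ⟶ B') :
    (conj f ⊗ₘ conj g) ≫ (dualTensor A' B').hom = (dualTensor A B).hom ≫ conj (f ⊗ₘ g) := by
  apply cup_cancel
  rw [whiskerLeft_comp, whiskerLeft_comp, Category.assoc, Category.assoc, dualTensor_cup, conj_cup,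
    whisker_exchange_assoc, dualTensor_cup, DaggerSMC.dagger_tensor, cup₂, cup₂,
    reassoc_of% tensorμ_natural_right A' B' (conj f) (conj g),
    reassoc_of% tensorμ_natural_left (f†) (g†) (dual A) (dual B),
    tensorHom_comp_tensorHom_assoc, tensorHom_comp_tensorHom_assoc, conj_cup, conj_cup]

theorem dualTensor_natural_left {A A' : C} (f : A ⟶ A') (B : C) :
    conj f ▷ dual B ≫ (dualTensor A' B).hom = (dualTensor A B).hom ≫ conj (f ▷ B) := by
  have := dualTensor_natural f (𝟙 B)
  rwa [conj_id, tensorHom_id, tensorHom_id] at this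

theorem dualTensor_natural_right (A : C) {B B' : C} (g : B ⟶ B') :
    dual A ◁ conj g ≫ (dualTensor A B').hom = (dualTensor A B).hom ≫ conj (A ◁ g) := by
  have := dualTensor_natural (𝟙 A) g
  rwa [conj_id, id_tensorHom, id_tensorHom] at this

theorem dualTensor_assoc (X Y Z : C) :
    (dualTensor X Y).hom ▷ dual Z ≫ (dualTensor (X ⊗ Y) Z).hom ≫ conj (α_ X Y Z).hom =
      (α_ (dual X) (dual Y) (dual Z)).hom ≫ dual X ◁ (dualTensor Y Z).hom ≫
        (dualTensor X (Y ⊗ Z)).hom := by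
  apply cup_cancel
  have h1 : ((X ⊗ Y) ⊗ Z) ◁ ((dualTensor X Y).hom ▷ dual Z) ≫ cup₂ (X ⊗ Y) Z =
      tensorμ (X ⊗ Y) Z (dual X ⊗ dual Y) (dual Z) ≫ (cup₂ X Y ⊗ₘ cup Z) ≫ (λ_ (𝟙_ C)).hom := by
    have := tensorμ_natural_right (X ⊗ Y) Z (dualTensor X Y).hom (𝟙 (dual Z))
    rw [tensorHom_id] at this
    rw [cup₂, reassoc_of% this, tensorHom_comp_tensorHom_assoc, dualTensor_cup, whiskerLeft_id,
      Category.id_comp]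
  have h2 : (X ⊗ Y ⊗ Z) ◁ (dual X ◁ (dualTensor Y Z).hom) ≫ cup₂ X (Y ⊗ Z) =
      tensorμ X (Y ⊗ Z) (dual X) (dual Y ⊗ dual Z) ≫ (cup X ⊗ₘ cup₂ Y Z) ≫ (λ_ (𝟙_ C)).hom := by
    have := tensorμ_natural_right X (Y ⊗ Z) (𝟙 (dual X)) (dualTensor Y Z).hom
    rw [id_tensorHom] at this
    rw [cup₂, reassoc_of% this, tensorHom_comp_tensorHom_assoc, dualTensor_cup, whiskerLeft_id,
      Category.id_comp]
  have h3 := associator_monoidal X Y Z (dual X) (dual Y) (dual Z)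
  simp only [whiskerLeft_comp, Category.assoc]
  rw [conj_cup, whisker_exchange_assoc, whisker_exchange_assoc, dualTensor_cup, h1, dualTensor_cup,
    h2, DaggerSMC.dagger_associator]
  rw [← cancel_epi ((α_ X Y Z).hom ▷ ((dual X ⊗ dual Y) ⊗ dual Z)), hom_inv_whiskerRight_assoc]
  have h4 : (α_ X Y Z).hom ▷ ((dual X ⊗ dual Y) ⊗ dual Z) ≫
      (X ⊗ Y ⊗ Z) ◁ (α_ (dual X) (dual Y) (dual Z)).hom =
        (α_ X Y Z).hom ⊗ₘ (α_ (dual X) (dual Y) (dual Z)).hom := by rw [MonoidalCategory.tensorHom_def]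
  rw [reassoc_of% h4]
  have h5 : (cup₂ X Y ⊗ₘ cup Z) ≫ (λ_ (𝟙_ C)).hom = tensorμ X Y (dual X) (dual Y) ▷ _ ≫
      (α_ _ _ _).hom ≫ (cup X ⊗ₘ cup Y ⊗ₘ cup Z) ≫ (λ_ _).hom ≫ (λ_ _).hom := by
    rw [cup₂]; simp only [MonoidalCategory.tensorHom_def]; monoidal
  have h6 : (cup X ⊗ₘ cup₂ Y Z) ≫ (λ_ (𝟙_ C)).hom = _ ◁ tensorμ Y Z (dual Y) (dual Z) ≫
      (cup X ⊗ₘ cup Y ⊗ₘ cup Z) ≫ (λ_ _).hom ≫ (λ_ _).hom := by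
    rw [cup₂, ← id_tensorHom, tensorHom_comp_tensorHom_assoc, Category.id_comp]
    have : cup X ⊗ₘ (tensorμ Y Z (dual Y) (dual Z) ≫ (cup Y ⊗ₘ cup Z) ≫ (λ_ (𝟙_ C)).hom) =
      (cup X ⊗ₘ (tensorμ Y Z (dual Y) (dual Z) ≫ (cup Y ⊗ₘ cup Z))) ≫ _ ◁ (λ_ (𝟙_ C)).hom := by
      rw [← id_tensorHom, tensorHom_comp_tensorHom, Category.comp_id, Category.assoc]
    rw [this, Category.assoc, leftUnitor_naturality]
  rw [h5, h6, reassoc_of% h3]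

theorem dualTensor_leftUnit (X : C) :
    (λ_ (dual X)).hom = dualUnit.hom ▷ dual X ≫ (dualTensor (𝟙_ C) X).hom ≫ conj (λ_ X).hom := by
  apply cup_cancel
  have h1 := tensorμ_natural_right (𝟙_ C) X (dualUnit (C := C)).hom (𝟙 (dual X))
  rw [tensorHom_id] at h1
  have h2 := leftUnitor_monoidal X (dual X)
  simp only [whiskerLeft_comp, Category.assoc]
  rw [conj_cup, whisker_exchange_assoc, whisker_exchange_assoc, dualTensor_cup, cup₂,
    reassoc_of% h1, tensorHom_comp_tensorHom_assoc, dualUnit_cup, DaggerSMC.dagger_leftUnitor,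
    whiskerLeft_id, Category.id_comp, ← cancel_epi ((λ_ X).hom ▷ (𝟙_ C ⊗ dual X)),
    hom_inv_whiskerRight_assoc, ← tensorHom_def_assoc, h2]
  simp only [Category.assoc, MonoidalCategory.tensorHom_def, unitors_equal]
  rw [← unitors_equal, leftUnitor_naturality]

theorem dualTensor_rightUnit (X : C) :
    (ρ_ (dual X)).hom = dual X ◁ dualUnit.hom ≫ (dualTensor X (𝟙_ C)).hom ≫ conj (ρ_ X).hom := by
  apply cup_cancel
  have h1 := tensorμ_natural_right X (𝟙_ C) (𝟙 (dual X)) (dualUnit (C := C)).hom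
  rw [id_tensorHom] at h1
  have h2 := rightUnitor_monoidal X (dual X)
  simp only [whiskerLeft_comp, Category.assoc]
  rw [conj_cup, whisker_exchange_assoc, whisker_exchange_assoc, dualTensor_cup, cup₂,
    reassoc_of% h1, tensorHom_comp_tensorHom_assoc, dualUnit_cup, DaggerSMC.dagger_rightUnitor,
    whiskerLeft_id, Category.id_comp, ← cancel_epi ((ρ_ X).hom ▷ (dual X ⊗ 𝟙_ C)),
    hom_inv_whiskerRight_assoc, ← tensorHom_def_assoc, h2]
  simp only [Category.assoc, tensorHom_def', unitors_equal]
  rw [rightUnitor_naturality]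

theorem tensorμ_braid (A B A' B' : C) :
    ((β_ A B).hom ⊗ₘ (β_ A' B').hom) ≫ tensorμ B A B' A' =
      tensorμ A B A' B' ≫ (β_ (A ⊗ A') (B ⊗ B')).hom := by
  simp [tensorμ, SymmetricCategory.braiding_swap_eq_inv_braiding A' B,
    MonoidalCategory.tensorHom_def]

theorem dualTensor_braid (X Y : C) : (dualTensor X Y).hom ≫ conj (β_ X Y).hom =
    (β_ (dual X) (dual Y)).hom ≫ (dualTensor Y X).hom := by
  apply cup_cancel
  have h := tensorμ_braid Y X (dual Y) (dual X)
  simp only [whiskerLeft_comp, Category.assoc]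
  rw [conj_cup, whisker_exchange_assoc, dualTensor_cup, dualTensor_cup, DaggerSMC.dagger_braiding,
    cup₂, cup₂]
  rw [← cancel_epi ((Y ⊗ X) ◁ (β_ (dual Y) (dual X)).hom), ← tensorHom_def'_assoc,
    reassoc_of% h, ← whiskerLeft_comp_assoc, SymmetricCategory.symmetry, whiskerLeft_id,
    Category.id_comp, ← BraidedCategory.braiding_naturality_assoc, braiding_leftUnitor,
    unitors_equal]

instance conjMonoidal : (conjFunctor C).Monoidal :=
  Functor.CoreMonoidal.toMonoidal
    { εIso := dualUnit
      μIso := dualTensor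
      μIso_hom_natural_left := dualTensor_natural_left
      μIso_hom_natural_right := fun X f => dualTensor_natural_right X f
      associativity := dualTensor_assoc
      left_unitality := dualTensor_leftUnit
      right_unitality := dualTensor_rightUnit }

open Functor.LaxMonoidal Functor.OplaxMonoidal

variable (C) in
/-- The doubling functor `A ↦ A ⊗ A*`, `f ↦ f ⊗ f_*`. -/
def double : C ⥤ C := Functor.prod' (𝟭 C) (conjFunctor C) ⋙ tensor C

instance doubleMonoidal : (double C).Monoidal :=
  inferInstanceAs (Functor.prod' (𝟭 C) (conjFunctor C) ⋙ tensor C).Monoidal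

theorem double_obj (A : C) : (double C).obj A = A ⊗ dual A := rfl

theorem double_map {A B : C} (f : A ⟶ B) : (double C).map f = f ⊗ₘ conj f := rfl

theorem double_μ (A B : C) : μ (double C) A B =
    tensorμ A (dual A) B (dual B) ≫ (A ⊗ B) ◁ (dualTensor A B).hom := by
  have h : μ (double C) A B = tensorμ A (dual A) B (dual B) ≫
    ((μ (Functor.prod' (𝟭 C) (conjFunctor C)) A B).1 ⊗ₘ
      (μ (Functor.prod' (𝟭 C) (conjFunctor C)) A B).2) := rfl
  rw [h, Functor.prod'_μ_fst, Functor.prod'_μ_snd, ← id_tensorHom]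
  rfl

theorem double_ε : ε (double C) = (λ_ (𝟙_ C)).inv ≫ (𝟙_ C) ◁ dualUnit.hom := by
  have h : ε (double C) = (λ_ (𝟙_ C)).inv ≫ ((ε (Functor.prod' (𝟭 C) (conjFunctor C))).1 ⊗ₘ
      (ε (Functor.prod' (𝟭 C) (conjFunctor C))).2) := rfl
  rw [h, Functor.prod'_ε_fst, Functor.prod'_ε_snd, ← id_tensorHom]
  rfl

theorem tensorμ_tensorμ (A A' B B' : C) : tensorμ A A' B B' ≫ tensorμ A B A' B' = 𝟙 _ := by
  simp [tensorμ, SymmetricCategory.braiding_swap_eq_inv_braiding A' B]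

instance doubleBraided : (double C).Braided where
  braided X Y := by
    have h := tensorμ_braid X Y (dual X) (dual Y)
    have h2 : tensorμ X (dual X) Y (dual Y) ≫ ((β_ X Y).hom ⊗ₘ (β_ (dual X) (dual Y)).hom) =
        (β_ (X ⊗ dual X) (Y ⊗ dual Y)).hom ≫ tensorμ Y (dual Y) X (dual X) := by
      rw [← Category.comp_id ((β_ X Y).hom ⊗ₘ _), ← tensorμ_tensorμ Y X (dual Y) (dual X),
        reassoc_of% h, reassoc_of% tensorμ_tensorμ X (dual X) Y (dual Y)]
    have h3 : (tensorμ X (dual X) Y (dual Y) ≫ (X ⊗ Y) ◁ (dualTensor X Y).hom) ≫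
        ((β_ X Y).hom ⊗ₘ conj (β_ X Y).hom) = (β_ (X ⊗ dual X) (Y ⊗ dual Y)).hom ≫
          tensorμ Y (dual Y) X (dual X) ≫ (Y ⊗ X) ◁ (dualTensor Y X).hom := by
      rw [← reassoc_of% h2, Category.assoc, ← id_tensorHom, ← id_tensorHom,
        tensorHom_comp_tensorHom, tensorHom_comp_tensorHom, dualTensor_braid, Category.id_comp,
        Category.comp_id]
    rw [double_μ, double_μ]
    exact h3

theorem cup_unit : ε (double C) ≫ cup (𝟙_ C) = 𝟙 (𝟙_ C) := by
  rw [double_ε]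
  refine (Category.assoc _ _ _).trans ?_
  refine (congrArg ((λ_ (𝟙_ C)).inv ≫ ·) dualUnit_cup).trans ?_
  rw [← unitors_equal, Iso.inv_hom_id]

theorem cup_tensor (A B : C) : μ (double C) A B ≫ cup (A ⊗ B) =
    (cup A ⊗ₘ cup B) ≫ (λ_ (𝟙_ C)).hom := by
  rw [double_μ]
  refine (Category.assoc _ _ _).trans ?_
  refine (congrArg (tensorμ A (dual A) B (dual B) ≫ ·) (dualTensor_cup A B)).trans ?_
  rw [cup₂, reassoc_of% tensorμ_tensorμ]

/-- The cup `A ⊗ A* ⟶ 1` as a discard map on the doubled object. -/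
def trace (A : C) : (double C).obj A ⟶ 𝟙_ C := cup A

/-- The doubling of `f : A ⟶ B ⊗ X`: the morphism `A ⊗ A* ⟶ B ⊗ B*` obtained from `f ⊗ f_*` by
joining the wires `X` and `X*` by a cup. -/
def Purification.doubled {A B : C} (p : Purification A B) : (double C).obj A ⟶ (double C).obj B :=
  (double C).map p.map ≫ discardSnd (double C) trace B p.env

theorem discardSnd_natural {B B' : C} (f : B ⟶ B') (X : C) :
    (double C).map (f ▷ X) ≫ discardSnd (double C) trace B' X =
      discardSnd (double C) trace B X ≫ (double C).map f := by
  simp only [discardSnd, Category.assoc]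
  rw [← δ_natural_left_assoc, ← whisker_exchange_assoc, rightUnitor_naturality]

theorem trace_tensor (A B : C) : trace (A ⊗ B) =
    δ (double C) A B ≫ (trace A ⊗ₘ trace B) ≫ (λ_ (𝟙_ C)).hom := by
  rw [← cancel_epi (μ (double C) A B), Functor.Monoidal.μ_δ_assoc]
  exact cup_tensor A B

theorem trace_unit : trace (𝟙_ C) = η (double C) := by
  rw [← cancel_epi (ε (double C)), Functor.Monoidal.ε_η]
  exact cup_unit

theorem discardSnd_comp (B X Y : C) :
    discardSnd (double C) trace (B ⊗ X) Y ≫ discardSnd (double C) trace B X =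
      (double C).map (α_ B X Y).hom ≫ discardSnd (double C) trace B (X ⊗ Y) := by
  have h : ∀ {P Q R : C} (m : Q ⟶ 𝟙_ C) (n : R ⟶ 𝟙_ C),
      (P ⊗ Q) ◁ n ≫ (ρ_ _).hom ≫ P ◁ m ≫ (ρ_ P).hom =
        (α_ _ _ _).hom ≫ P ◁ ((m ⊗ₘ n) ≫ (λ_ (𝟙_ C)).hom) ≫ (ρ_ P).hom := by
    intro P Q R m n
    rw [tensorHom_def']
    monoidal
  rw [discardSnd, discardSnd, discardSnd, trace_tensor, Functor.Monoidal.map_associator,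
    whiskerLeft_comp (W := (double C).obj B) (δ (double C) X Y)]
  simp only [Category.assoc, Functor.Monoidal.μ_δ_assoc,
    Functor.Monoidal.whiskerLeft_μ_δ_assoc]
  rw [← rightUnitor_naturality_assoc, whisker_exchange_assoc, h]

theorem discardSnd_unit (B : C) :
    (double C).map (ρ_ B).inv ≫ discardSnd (double C) trace B (𝟙_ C) = 𝟙 _ := by
  rw [discardSnd, trace_unit, Functor.Monoidal.map_rightUnitor_inv]
  simp

theorem discardSnd_whiskerLeft (Z B X : C) :
    δ (double C) Z (B ⊗ X) ≫ (double C).obj Z ◁ discardSnd (double C) trace B X ≫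
        μ (double C) Z B =
      (double C).map (α_ Z B X).inv ≫ discardSnd (double C) trace (Z ⊗ B) X := by
  have h : ∀ {P Q R : C} (n : R ⟶ 𝟙_ C), P ◁ Q ◁ n ≫ P ◁ (ρ_ Q).hom =
      (α_ _ _ _).inv ≫ (P ⊗ Q) ◁ n ≫ (ρ_ (P ⊗ Q)).hom := by
    intro P Q R n
    monoidal
  rw [discardSnd, discardSnd, Functor.Monoidal.map_associator_inv]
  simp only [Category.assoc, Functor.Monoidal.μ_δ_assoc, whiskerLeft_comp]
  rw [reassoc_of% h, ← whisker_exchange_assoc, rightUnitor_naturality]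

variable (C) in
/-- Objects of `CPM(C)`: the same as those of `C`. -/
structure CPM where
  obj : C

namespace CPM

/-- A morphism `A ⟶ B` of `CPM(C)`: a morphism `A ⊗ A* ⟶ B ⊗ B*` of `C` which is the doubling of
some `f : A ⟶ B ⊗ X`. -/
@[ext]
structure Hom (A B : CPM C) where
  val : (double C).obj A.obj ⟶ (double C).obj B.obj
  property : ∃ p : Purification A.obj B.obj, p.doubled = val

theorem pure_mem {A B : C} (f : A ⟶ B) :
    ∃ p : Purification A B, p.doubled = (double C).map f := by
  refine ⟨⟨𝟙_ C, f ≫ (ρ_ B).inv⟩, ?_⟩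
  rw [Purification.doubled, Functor.map_comp, Category.assoc, discardSnd_unit, Category.comp_id]

theorem comp_mem {X Y Z : C} (p : Purification X Y) (q : Purification Y Z) :
    ∃ r : Purification X Z, r.doubled = p.doubled ≫ q.doubled := by
  refine ⟨⟨q.env ⊗ p.env, p.map ≫ q.map ▷ p.env ≫ (α_ _ _ _).hom⟩, ?_⟩
  simp only [Purification.doubled, Functor.map_comp, Category.assoc]
  rw [← discardSnd_comp, reassoc_of% discardSnd_natural]

/-- Composition in `CPM(C)` is composition in `C`. -/
instance : Category (CPM C) where
  Hom := Hom
  id A := ⟨𝟙 _, by simpa using pure_mem (𝟙 A.obj)⟩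
  comp f g := ⟨f.val ≫ g.val, by
    obtain ⟨_, ⟨p, rfl⟩⟩ := f
    obtain ⟨_, ⟨q, rfl⟩⟩ := g
    exact comp_mem p q⟩

@[ext]
theorem hom_ext {A B : CPM C} {f g : A ⟶ B} (h : f.val = g.val) : f = g := Hom.ext h

variable (C) in
/-- The inclusion of the morphisms of `CPM(C)` into those of `C`. -/
def forget : CPM C ⥤ C where
  obj A := (double C).obj A.obj
  map f := f.val

instance : (forget C).Faithful where
  map_injective h := hom_ext h

variable (C) in
/-- The functor `C ⥤ CPM(C)`, sending `f` to `f ⊗ f_*`. -/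
def incl : C ⥤ CPM C where
  obj A := ⟨A⟩
  map f := ⟨(double C).map f, pure_mem f⟩
  map_id A := hom_ext ((double C).map_id A)
  map_comp f g := hom_ext ((double C).map_comp f g)

theorem whiskerLeft_mem (Z : C) {A B : C} (p : Purification A B) :
    ∃ q : Purification (Z ⊗ A) (Z ⊗ B), q.doubled =
      δ (double C) Z A ≫ (double C).obj Z ◁ p.doubled ≫ μ (double C) Z B := by
  refine ⟨⟨p.env, Z ◁ p.map ≫ (α_ _ _ _).inv⟩, ?_⟩
  simp only [Purification.doubled, Functor.map_comp, Category.assoc, whiskerLeft_comp]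
  rw [← discardSnd_whiskerLeft, ← δ_natural_right_assoc]

theorem whiskerRight_mem {A B : C} (p : Purification A B) (Z : C) :
    ∃ q : Purification (A ⊗ Z) (B ⊗ Z), q.doubled =
      δ (double C) A Z ≫ p.doubled ▷ (double C).obj Z ≫ μ (double C) B Z := by
  obtain ⟨q, hq⟩ := whiskerLeft_mem Z p
  obtain ⟨r₁, h₁⟩ := pure_mem (β_ A Z).hom
  obtain ⟨r₂, h₂⟩ := pure_mem (β_ Z B).hom
  obtain ⟨s, hs⟩ := comp_mem r₁ q
  obtain ⟨t, ht⟩ := comp_mem s r₂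
  refine ⟨t, ?_⟩
  rw [ht, hs, h₁, h₂, hq, Functor.map_braiding, Functor.map_braiding]
  simp

/-- The tensor product of `CPM(C)`: on objects that of `C`, on morphisms the tensor product in `C`
conjugated by the canonical isomorphism `(A ⊗ A*) ⊗ (B ⊗ B*) ≅ (A ⊗ B) ⊗ (A ⊗ B)*`. -/
instance : MonoidalCategoryStruct (CPM C) where
  tensorObj A B := ⟨A.obj ⊗ B.obj⟩
  tensorUnit := ⟨𝟙_ C⟩
  tensorHom {A A' B B'} f g := ⟨δ (double C) A.obj B.obj ≫ (f.val ⊗ₘ g.val) ≫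
      μ (double C) A'.obj B'.obj, by
    obtain ⟨_, ⟨p, rfl⟩⟩ := f
    obtain ⟨_, ⟨q, rfl⟩⟩ := g
    obtain ⟨r, hr⟩ := whiskerRight_mem p B.obj
    obtain ⟨s, hs⟩ := whiskerLeft_mem A'.obj q
    obtain ⟨t, ht⟩ := comp_mem r s
    refine ⟨t, ?_⟩
    rw [ht, hr, hs, MonoidalCategory.tensorHom_def]
    simp⟩
  whiskerLeft Z A B f := ⟨δ (double C) Z.obj A.obj ≫ (double C).obj Z.obj ◁ f.val ≫
      μ (double C) Z.obj B.obj, by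
    obtain ⟨_, ⟨p, rfl⟩⟩ := f
    exact whiskerLeft_mem Z.obj p⟩
  whiskerRight {A B} f Z := ⟨δ (double C) A.obj Z.obj ≫ f.val ▷ (double C).obj Z.obj ≫
      μ (double C) B.obj Z.obj, by
    obtain ⟨_, ⟨p, rfl⟩⟩ := f
    exact whiskerRight_mem p Z.obj⟩
  associator X Y Z := (incl C).mapIso (α_ X.obj Y.obj Z.obj)
  leftUnitor X := (incl C).mapIso (λ_ X.obj)
  rightUnitor X := (incl C).mapIso (ρ_ X.obj)

variable (C) in
/-- The inclusion of `CPM(C)` into `C` is compatible with the tensor products. -/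
def inducing : Monoidal.InducingFunctorData (forget C) where
  μIso X Y := Functor.Monoidal.μIso (double C) X.obj Y.obj
  εIso := Functor.Monoidal.εIso (double C)
  whiskerLeft_eq _ _ _ _ := rfl
  whiskerRight_eq _ _ := rfl
  tensorHom_eq _ _ := rfl
  associator_eq X Y Z := by
    change (double C).map (α_ X.obj Y.obj Z.obj).hom =
      (δ (double C) (X.obj ⊗ Y.obj) Z.obj ≫ (δ (double C) X.obj Y.obj ⊗ₘ 𝟙 _)) ≫ (α_ _ _ _).hom ≫
        (𝟙 _ ⊗ₘ μ (double C) Y.obj Z.obj) ≫ μ (double C) X.obj (Y.obj ⊗ Z.obj)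
    rw [Functor.Monoidal.map_associator, tensorHom_id, id_tensorHom, Category.assoc]
  leftUnitor_eq X := by
    change (double C).map (λ_ X.obj).hom =
      (δ (double C) (𝟙_ C) X.obj ≫ (η (double C) ⊗ₘ 𝟙 _)) ≫ (λ_ _).hom
    rw [Functor.Monoidal.map_leftUnitor, tensorHom_id, Category.assoc]
  rightUnitor_eq X := by
    change (double C).map (ρ_ X.obj).hom =
      (δ (double C) X.obj (𝟙_ C) ≫ (𝟙 _ ⊗ₘ η (double C))) ≫ (ρ_ _).hom
    rw [Functor.Monoidal.map_rightUnitor, id_tensorHom, Category.assoc]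

instance : MonoidalCategory (CPM C) := Monoidal.induced (forget C) (inducing C)

instance : (forget C).Monoidal := Monoidal.fromInducedMonoidal (forget C) (inducing C)

instance : BraidedCategory (CPM C) :=
  BraidedCategory.ofFaithful (forget C) (fun X Y => (incl C).mapIso (β_ X.obj Y.obj))
    (fun X Y => Functor.LaxBraided.braided (F := double C) X.obj Y.obj)

instance : (forget C).Braided where
  braided X Y := Functor.LaxBraided.braided (F := double C) X.obj Y.obj

instance : SymmetricCategory (CPM C) := SymmetricCategory.ofFaithful (forget C)

theorem map_whiskerLeft (X : C) {Y Z : C} (f : Y ⟶ Z) :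
    (incl C).map (X ◁ f) = (incl C).obj X ◁ (incl C).map f :=
  hom_ext (Functor.Monoidal.map_whiskerLeft (double C) X f)

theorem map_whiskerRight {Y Z : C} (f : Y ⟶ Z) (X : C) :
    (incl C).map (f ▷ X) = (incl C).map f ▷ (incl C).obj X :=
  hom_ext (Functor.Monoidal.map_whiskerRight (double C) f X)

instance : (incl C).Monoidal :=
  Functor.CoreMonoidal.toMonoidal
    { εIso := Iso.refl _
      μIso := fun _ _ => Iso.refl _
      μIso_hom_natural_left := fun f X => by
        rw [map_whiskerRight]; exact (Category.comp_id _).trans (Category.id_comp _).symm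
      μIso_hom_natural_right := fun X f => by
        rw [map_whiskerLeft]; exact (Category.comp_id _).trans (Category.id_comp _).symm
      associativity := fun X Y Z => by
        simp only [Iso.refl_hom]
        erw [id_whiskerRight, whiskerLeft_id, Category.id_comp, Category.id_comp, Category.comp_id,
          Category.comp_id]
        rfl
      left_unitality := fun X => by
        simp only [Iso.refl_hom]
        erw [id_whiskerRight, Category.id_comp, Category.id_comp]
        rfl
      right_unitality := fun X => by
        simp only [Iso.refl_hom]
        erw [whiskerLeft_id, Category.id_comp, Category.id_comp]
        rfl }

instance : (incl C).Braided where
  braided _ _ := (Category.id_comp _).trans (Category.comp_id _).symm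

theorem disc_mem (A : C) :
    ∃ p : Purification A (𝟙_ C), p.doubled = trace A ≫ ε (double C) := by
  refine ⟨⟨A, (λ_ A).inv⟩, ?_⟩
  rw [Purification.doubled, discardSnd, Functor.Monoidal.map_leftUnitor_inv]
  simp only [Category.assoc, Functor.Monoidal.μ_δ_assoc]
  rw [← whisker_exchange_assoc, rightUnitor_naturality, ← leftUnitor_inv_naturality_assoc,
    ← unitors_equal, Iso.inv_hom_id_assoc]

variable (C) in
/-- The discard maps of `CPM(C)`, given by the cups. -/
def disc (A : C) : (incl C).obj A ⟶ 𝟙_ (CPM C) := ⟨trace A ≫ ε (double C), disc_mem A⟩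

end CPM

end Compact

/-! ### Equivalence of categories with discard maps -/

section Equivalent

variable {C : Type u} [Category.{v} C] [MonoidalCategory C] [SymmetricCategory C]

/-- Two symmetric monoidal extensions `ι : C ⥤ D`, `ι' : C ⥤ D'` of `C` with discard maps are
equivalent: there is an equivalence `D ≌ D'` of symmetric monoidal categories which commutes with
`ι` and `ι'` up to a monoidal natural isomorphism and which preserves the discard maps. -/
def EquivalentOver {D : Type u'} [Category.{v'} D] [MonoidalCategory D] [SymmetricCategory D]
    (ι : C ⥤ D) [ι.Braided] (disc : ∀ X : C, ι.obj X ⟶ 𝟙_ D)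
    {D' : Type u''} [Category.{v''} D'] [MonoidalCategory D'] [SymmetricCategory D']
    (ι' : C ⥤ D') [ι'.Braided] (disc' : ∀ X : C, ι'.obj X ⟶ 𝟙_ D') : Prop :=
  ∃ (E : D ≌ D') (_ : E.functor.Braided) (θ : ι ⋙ E.functor ≅ ι'),
    NatTrans.IsMonoidal θ.hom ∧
      ∀ A : C, E.functor.map (disc A) ≫ Functor.OplaxMonoidal.η E.functor =
        θ.hom.app A ≫ disc' A

end Equivalent

end Discarding

open Discarding

/-! Every extension of `C` with discard maps turns a purification `p`, a map `A ⟶ B ⊗ X`, into the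
morphism `p.realize` obtained by discarding `X`. The theorem compares the equalities between such
morphisms in `DiscardCat C` and in `CPM C`; in both categories every morphism is of this form.

In `DiscardCat C`, two purifications have the same realization exactly when they are linked by a
zigzag of isometries (`DiscardCat.realize_eq_iff`). Zigzags give equal realizations because a
discard map absorbs isometries. Conversely, pulling all discards of a formal diagram to the end
yields a purification (`Diagram.purify`), and each generating relation of the congruence becomes a
zigzag (`Diagram.Rel.purify`), almost always by a structural isomorphism of the environments. Hence
the uniqueness axiom of an environment structure is literally the statement that `∼_CP` is `∼_iso⁺`.
The remaining axioms hold for every `C`, which gives the first equivalence.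

In `CPM C`, two purifications have the same realization exactly when `∼_CP` relates them
(`CPM.realize_eq_iff`): the doubled morphism and the morphism defining `∼_CP` differ only by bending
wires with cups (`bend_doubled`). The comparison functor `DiscardCat.toCPM` preserves realizations,
so it is always full, and it is faithful once `∼_CP` implies `∼_iso⁺`. Conversely, any equivalence
over `C` that preserves discards carries realizations to realizations up to the natural isomorphism
(`map_realize_eq`). It therefore identifies the two relations. -/

namespace Discarding

/-! ### Coherence of the middle interchange `tensorμ`. -/

section Coherence

variable {C : Type u} [Category.{v} C] [MonoidalCategory C] [SymmetricCategory C]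

theorem tensorμ_comp_tensorμ (A A' B B' : C) : tensorμ A A' B B' ≫ tensorμ A B A' B' = 𝟙 _ := by
  simp [tensorμ, SymmetricCategory.braiding_swap_eq_inv_braiding A' B]

/-- Compatibility of the functor `⊗` on `C × C` with the braidings, written with the inverse of its
structure map, which is again a `tensorμ`. -/
theorem tensorHom_braiding_comp_tensorμ (A B A' B' : C) :
    ((β_ A B).hom ⊗ₘ (β_ A' B').hom) ≫ tensorμ B A B' A' =
      tensorμ A B A' B' ≫ (β_ (A ⊗ A') (B ⊗ B')).hom := by
  simp [tensorμ, SymmetricCategory.braiding_swap_eq_inv_braiding A' B,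
    MonoidalCategory.tensorHom_def]

end Coherence

/-! ### Closure properties of isometries; structural isomorphisms are isometries. -/

section Isometries

variable {C : Type u} [Category.{v} C] [MonoidalCategory C] [SymmetricCategory C] [DaggerSMC C]

open DaggerSMC

theorem IsIsometry.id (X : C) : IsIsometry (𝟙 X) := by
  rw [IsIsometry, dagger_id, Category.id_comp]

theorem IsIsometry.comp {X Y Z : C} {f : X ⟶ Y} {g : Y ⟶ Z} (hf : IsIsometry f)
    (hg : IsIsometry g) : IsIsometry (f ≫ g) := by
  rw [IsIsometry] at *
  rw [dagger_comp, Category.assoc, reassoc_of% hg, hf]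

theorem IsIsometry.tensor {X Y X' Y' : C} {f : X ⟶ Y} {g : X' ⟶ Y'} (hf : IsIsometry f)
    (hg : IsIsometry g) : IsIsometry (f ⊗ₘ g) := by
  rw [IsIsometry] at *
  rw [dagger_tensor, tensorHom_comp_tensorHom, hf, hg, id_tensorHom_id]

theorem IsIsometry.whiskerLeft (Z : C) {X Y : C} {f : X ⟶ Y} (hf : IsIsometry f) :
    IsIsometry (Z ◁ f) := by
  rw [← id_tensorHom]; exact (IsIsometry.id Z).tensor hf

theorem IsIsometry.whiskerRight {X Y : C} {f : X ⟶ Y} (hf : IsIsometry f) (Z : C) :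
    IsIsometry (f ▷ Z) := by
  rw [← tensorHom_id]; exact hf.tensor (IsIsometry.id Z)

theorem isIsometry_associator_hom (X Y Z : C) : IsIsometry (α_ X Y Z).hom := by
  rw [IsIsometry, dagger_associator, Iso.hom_inv_id]

theorem isIsometry_associator_inv (X Y Z : C) : IsIsometry (α_ X Y Z).inv := by
  have h : (α_ X Y Z).inv† = (α_ X Y Z).hom := by rw [← dagger_associator, dagger_dagger]
  rw [IsIsometry, h, Iso.inv_hom_id]

theorem isIsometry_leftUnitor_hom (X : C) : IsIsometry (λ_ X).hom := by
  rw [IsIsometry, dagger_leftUnitor, Iso.hom_inv_id]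

theorem isIsometry_rightUnitor_hom (X : C) : IsIsometry (ρ_ X).hom := by
  rw [IsIsometry, dagger_rightUnitor, Iso.hom_inv_id]

theorem isIsometry_braiding_hom (X Y : C) : IsIsometry (β_ X Y).hom := by
  rw [IsIsometry, dagger_braiding, SymmetricCategory.symmetry]

theorem isIsometry_tensorμ (A A' B B' : C) : IsIsometry (tensorμ A A' B B') := by
  refine (isIsometry_associator_hom _ _ _).comp (.comp ?_ (.comp ?_ (.comp ?_ ?_)))
  · exact (isIsometry_associator_inv _ _ _).whiskerLeft _
  · exact ((isIsometry_braiding_hom _ _).whiskerRight _).whiskerLeft _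
  · exact (isIsometry_associator_hom _ _ _).whiskerLeft _
  · exact isIsometry_associator_inv _ _ _

end Isometries

/-! ### Purifications up to zigzags of isometries: a congruence for composition and tensor. -/

section Purifications

variable {C : Type u} [Category.{v} C] [MonoidalCategory C] [SymmetricCategory C] [DaggerSMC C]

/-- Two purifications are dilation equivalent if they are related by a zigzag of isometries. -/
def DilationEquiv {A B : C} (p q : Purification A B) : Prop := Relation.TransGen IsoRel p q

theorem IsoRel.symm {A B : C} {p q : Purification A B} (h : IsoRel p q) : IsoRel q p := by
  obtain ⟨Z, u, v, hu, hv, h⟩ := h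
  exact ⟨Z, v, u, hv, hu, h.symm⟩

theorem DilationEquiv.symm {A B : C} {p q : Purification A B} (h : DilationEquiv p q) :
    DilationEquiv q p :=
  haveI : Std.Symm (IsoRel (A := A) (B := B)) := ⟨fun _ _ => IsoRel.symm⟩
  Std.Symm.symm (r := Relation.TransGen IsoRel) _ _ h

theorem DilationEquiv.trans {A B : C} {p q r : Purification A B} (h : DilationEquiv p q)
    (h' : DilationEquiv q r) : DilationEquiv p r :=
  Relation.TransGen.trans h h'

/-- One leg of the cospan is an identity. The categorical laws below need only this case, usually
with a structural isomorphism as `u`. -/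
theorem DilationEquiv.of_isometry {A B : C} {p q : Purification A B} (u : p.env ⟶ q.env)
    (hu : IsIsometry u) (h : p.map ≫ B ◁ u = q.map) : DilationEquiv p q :=
  Relation.TransGen.single ⟨q.env, u, 𝟙 _, hu, .id _, by rw [h, whiskerLeft_id, Category.comp_id]⟩

/-- Supplies reflexivity, which a transitive closure does not have by itself; here it comes from the
identity isometry. -/
theorem DilationEquiv.of_map_eq {A B X : C} {f g : A ⟶ B ⊗ X} (h : f = g) :
    DilationEquiv ⟨X, f⟩ ⟨X, g⟩ :=
  .of_isometry (𝟙 _) (.id _) (by simpa using h)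

namespace Purification

/-- A morphism, as a purification with trivial environment. -/
abbrev pure {A B : C} (f : A ⟶ B) : Purification A B := ⟨𝟙_ C, f ≫ (ρ_ B).inv⟩

/-- The identity of `A`, as a purification of the discard map of `A`. -/
abbrev discard (A : C) : Purification A (𝟙_ C) := ⟨A, (λ_ A).inv⟩

/-- Composition of purifications. -/
abbrev comp {X Y Z : C} (p : Purification X Y) (q : Purification Y Z) : Purification X Z :=
  ⟨q.env ⊗ p.env, p.map ≫ q.map ▷ p.env ≫ (α_ _ _ _).hom⟩

/-- Tensor product of purifications. -/
abbrev tensor {X Y X' Y' : C} (p : Purification X Y) (q : Purification X' Y') :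
    Purification (X ⊗ X') (Y ⊗ Y') :=
  ⟨p.env ⊗ q.env, (p.map ⊗ₘ q.map) ≫ tensorμ Y p.env Y' q.env⟩

/-- Precomposition of a purification with a morphism. -/
abbrev precomp {X Y Z : C} (f : X ⟶ Y) (p : Purification Y Z) : Purification X Z :=
  ⟨p.env, f ≫ p.map⟩

/-- Postcomposition of a purification with a morphism. -/
abbrev postcomp {X Y Z : C} (p : Purification X Y) (f : Y ⟶ Z) : Purification X Z :=
  ⟨p.env, p.map ≫ f ▷ p.env⟩

end Purification

open Purification

namespace DilationEquiv

/-- An isometry on the environment of `p` acts on a wire that `q` does not touch, so it slides past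
`q.map` and becomes an isometry on the composite environment. -/
theorem comp_congr_left {X Y Z : C} {p p' : Purification X Y} (h : DilationEquiv p p')
    (q : Purification Y Z) : DilationEquiv (p.comp q) (p'.comp q) := by
  refine Relation.TransGen.lift (fun p : Purification X Y => p.comp q) ?_ _ _ h
  rintro p p' ⟨W, u, v, hu, hv, h⟩
  refine ⟨q.env ⊗ W, q.env ◁ u, q.env ◁ v, hu.whiskerLeft _, hv.whiskerLeft _, ?_⟩
  have key : ∀ {E : C} (k : E ⟶ W), q.map ▷ E ≫ (α_ Z q.env E).hom ≫ Z ◁ q.env ◁ k =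
      Y ◁ k ≫ q.map ▷ W ≫ (α_ Z q.env W).hom := by
    intro E k
    rw [← associator_naturality_right, whisker_exchange_assoc]
  simp only [Purification.comp, Category.assoc]
  rw [key, key, reassoc_of% h]

theorem comp_congr_right {X Y Z : C} (p : Purification X Y) {q q' : Purification Y Z}
    (h : DilationEquiv q q') : DilationEquiv (p.comp q) (p.comp q') := by
  refine Relation.TransGen.lift (fun q : Purification Y Z => p.comp q) ?_ _ _ h
  rintro q q' ⟨W, u, v, hu, hv, h⟩
  refine ⟨W ⊗ p.env, u ▷ p.env, v ▷ p.env, hu.whiskerRight _, hv.whiskerRight _, ?_⟩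
  simp only [Purification.comp, Category.assoc]
  rw [← associator_naturality_middle, ← associator_naturality_middle, ← comp_whiskerRight_assoc,
    ← comp_whiskerRight_assoc, h]

theorem comp_congr {X Y Z : C} {p p' : Purification X Y} {q q' : Purification Y Z}
    (h : DilationEquiv p p') (h' : DilationEquiv q q') :
    DilationEquiv (p.comp q) (p'.comp q') :=
  (h.comp_congr_left q).trans (h'.comp_congr_right p')

theorem tensor_congr_left {X Y X' Y' : C} {p p' : Purification X Y} (h : DilationEquiv p p')
    (q : Purification X' Y') : DilationEquiv (p.tensor q) (p'.tensor q) := by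
  refine Relation.TransGen.lift (fun p : Purification X Y => p.tensor q) ?_ _ _ h
  rintro p p' ⟨W, u, v, hu, hv, h⟩
  refine ⟨W ⊗ q.env, u ▷ q.env, v ▷ q.env, hu.whiskerRight _, hv.whiskerRight _, ?_⟩
  -- Naturality of `tensorμ` lets a map on the first environment be applied before the environments
  -- are gathered.
  have key : ∀ {E : C} (k : E ⟶ W) (m : X ⟶ Y ⊗ E),
      ((m ⊗ₘ q.map) ≫ tensorμ Y E Y' q.env) ≫ (Y ⊗ Y') ◁ (k ▷ q.env) =
        ((m ≫ Y ◁ k) ⊗ₘ q.map) ≫ tensorμ Y W Y' q.env := by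
    intro E k m
    have := tensorμ_natural (𝟙 Y) k (𝟙 Y') (𝟙 q.env)
    have : (Y ◁ k ⊗ₘ 𝟙 _) ≫ tensorμ Y W Y' q.env = tensorμ Y E Y' q.env ≫ (Y ⊗ Y') ◁ k ▷ q.env := by
      simpa only [id_whiskerRight, id_tensorHom, tensorHom_id] using this
    rw [Category.assoc, ← this, tensorHom_comp_tensorHom_assoc, Category.comp_id]
  simp only [Purification.tensor]
  rw [key, key, h]

theorem tensor_congr_right {X Y X' Y' : C} (p : Purification X Y) {q q' : Purification X' Y'}
    (h : DilationEquiv q q') : DilationEquiv (p.tensor q) (p.tensor q') := by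
  refine Relation.TransGen.lift (fun q : Purification X' Y' => p.tensor q) ?_ _ _ h
  rintro q q' ⟨W, u, v, hu, hv, h⟩
  refine ⟨p.env ⊗ W, p.env ◁ u, p.env ◁ v, hu.whiskerLeft _, hv.whiskerLeft _, ?_⟩
  have key : ∀ {E : C} (k : E ⟶ W) (m : X' ⟶ Y' ⊗ E),
      ((p.map ⊗ₘ m) ≫ tensorμ Y p.env Y' E) ≫ (Y ⊗ Y') ◁ (p.env ◁ k) =
        (p.map ⊗ₘ (m ≫ Y' ◁ k)) ≫ tensorμ Y p.env Y' W := by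
    intro E k m
    have := tensorμ_natural (𝟙 Y) (𝟙 p.env) (𝟙 Y') k
    simp only [id_tensorHom, whiskerLeft_id] at this
    rw [Category.assoc, ← this, ← id_tensorHom, tensorHom_comp_tensorHom_assoc, Category.comp_id]
  simp only [Purification.tensor]
  rw [key, key, h]

theorem tensor_congr {X Y X' Y' : C} {p p' : Purification X Y} {q q' : Purification X' Y'}
    (h : DilationEquiv p p') (h' : DilationEquiv q q') :
    DilationEquiv (p.tensor q) (p'.tensor q') :=
  (h.tensor_congr_left q).trans (h'.tensor_congr_right p')

theorem pure_comp {X Y Z : C} (f : X ⟶ Y) (p : Purification Y Z) :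
    DilationEquiv ((pure f).comp p) (p.precomp f) :=
  .of_isometry (ρ_ p.env).hom (isIsometry_rightUnitor_hom _) (by simp)

theorem comp_pure {X Y Z : C} (p : Purification X Y) (f : Y ⟶ Z) :
    DilationEquiv (p.comp (pure f)) (p.postcomp f) :=
  .of_isometry (λ_ p.env).hom (isIsometry_leftUnitor_hom _) (by simp)

theorem assoc {W X Y Z : C} (p : Purification W X) (q : Purification X Y)
    (r : Purification Y Z) : DilationEquiv ((p.comp q).comp r) (p.comp (q.comp r)) :=
  .of_isometry (α_ _ _ _).inv (isIsometry_associator_inv _ _ _) (by simp)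

/-- The two environments hold the same four factors, with the middle two swapped; `tensorμ` performs
the swap and is an isometry. -/
theorem tensor_comp {X Y Z X' Y' Z' : C} (p : Purification X Y) (q : Purification Y Z)
    (p' : Purification X' Y') (q' : Purification Y' Z') :
    DilationEquiv ((p.tensor p').comp (q.tensor q')) ((p.comp q).tensor (p'.comp q')) := by
  refine .of_isometry (tensorμ _ _ _ _) (isIsometry_tensorμ _ _ _ _) ?_
  have h := associator_monoidal Z q.env p.env Z' q'.env p'.env
  simp only [Purification.comp, Purification.tensor, Category.assoc, comp_whiskerRight]
  have h1 := tensorμ_natural q.map (𝟙 p.env) q'.map (𝟙 p'.env)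
  rw [id_tensorHom_id, tensorHom_id, tensorHom_id, tensorHom_id] at h1
  -- `q.map` and `q'.map` move ahead of the interchange, the associativity coherence is applied, and
  -- the `tensorμ` it leaves on the environments cancels the chosen isometry.
  rw [← reassoc_of% h1, reassoc_of% h, ← whiskerLeft_comp, tensorμ_comp_tensorμ, whiskerLeft_id,
    Category.comp_id, tensorHom_comp_tensorHom_assoc, tensorHom_comp_tensorHom_assoc]
  simp only [Category.assoc]

end DilationEquiv

end Purifications

/-! ### Purification of formal diagrams respects the defining congruence. -/

section Normalization

variable {C : Type u} [Category.{v} C] [MonoidalCategory C] [SymmetricCategory C] [DaggerSMC C]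

open Purification

namespace DilationEquiv

theorem pure_tensor_pure {X Y X' Y' : C} (f : X ⟶ Y) (g : X' ⟶ Y') :
    DilationEquiv (pure (f ⊗ₘ g)) ((pure f).tensor (pure g)) := by
  refine .symm (.of_isometry (λ_ (𝟙_ C)).hom (isIsometry_leftUnitor_hom _) ?_)
  simp only [Purification.tensor, Purification.pure, Category.assoc]
  have h := rightUnitor_monoidal Y Y'
  rw [← cancel_mono (ρ_ (Y ⊗ Y')).hom, Category.assoc, Category.assoc, Category.assoc,
    ← h, tensorHom_comp_tensorHom]
  simp

theorem tensor_associator {X Y X' Y' X'' Y'' : C} (p : Purification X Y)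
    (p' : Purification X' Y') (p'' : Purification X'' Y'') :
    DilationEquiv (((p.tensor p').tensor p'').postcomp (α_ Y Y' Y'').hom)
      ((p.tensor (p'.tensor p'')).precomp (α_ X X' X'').hom) := by
  refine .of_isometry (α_ _ _ _).hom (isIsometry_associator_hom _ _ _) ?_
  have h := tensor_associativity Y p.env Y' p'.env Y'' p''.env
  simp only [Purification.tensor, Purification.precomp, Purification.postcomp, Category.assoc]
  have h1 : ((p.map ⊗ₘ p'.map) ≫ tensorμ Y p.env Y' p'.env) ⊗ₘ p''.map =
      ((p.map ⊗ₘ p'.map) ⊗ₘ p''.map) ≫ tensorμ Y p.env Y' p'.env ▷ _ := by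
    rw [← tensorHom_id, tensorHom_comp_tensorHom, Category.comp_id]
  have h2 : p.map ⊗ₘ ((p'.map ⊗ₘ p''.map) ≫ tensorμ Y' p'.env Y'' p''.env) =
      (p.map ⊗ₘ (p'.map ⊗ₘ p''.map)) ≫ _ ◁ tensorμ Y' p'.env Y'' p''.env := by
    rw [← id_tensorHom, tensorHom_comp_tensorHom, Category.comp_id]
  rw [← MonoidalCategory.tensorHom_def, h1, h2, Category.assoc, h, associator_naturality_assoc,
    Category.assoc]

theorem pure_tensor {X Y : C} (A : C) (p : Purification X Y) :
    DilationEquiv ((pure (𝟙 A)).tensor p)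
      ⟨p.env, A ◁ p.map ≫ (α_ A Y p.env).inv⟩ := by
  refine .of_isometry (λ_ _).hom (isIsometry_leftUnitor_hom _) ?_
  simp only [Purification.tensor, Purification.pure, tensorμ, Category.id_comp]
  rw [MonoidalCategory.tensorHom_def']
  simp only [whiskerRight_tensor]
  simp [← whiskerLeft_comp_assoc, -whiskerLeft_comp]

/-- Unlike in `pure_tensor`, the environment stands to the left of `A` and must cross it, hence the
braiding. -/
theorem tensor_pure {X Y : C} (p : Purification X Y) (A : C) :
    DilationEquiv (p.tensor (pure (𝟙 A)))
      ⟨p.env, p.map ▷ A ≫ (α_ _ _ _).hom ≫ Y ◁ (β_ _ _).hom ≫ (α_ _ _ _).inv⟩ := by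
  refine .of_isometry (ρ_ _).hom (isIsometry_rightUnitor_hom _) ?_
  simp only [Purification.tensor, Purification.pure, tensorμ, Category.id_comp]
  rw [MonoidalCategory.tensorHom_def]
  simp

theorem tensor_braiding {X Y X' Y' : C} (p : Purification X Y) (p' : Purification X' Y') :
    DilationEquiv ((p.tensor p').postcomp (β_ Y Y').hom)
      ((p'.tensor p).precomp (β_ X X').hom) := by
  refine .of_isometry (β_ _ _).hom (isIsometry_braiding_hom _ _) ?_
  have h := tensorHom_braiding_comp_tensorμ Y Y' p.env p'.env
  have h' := tensorμ_comp_tensorμ Y' Y p'.env p.env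
  -- The coherence `h` with both interchanges moved to the opposite sides, which is possible because
  -- they are invertible.
  have h2 : tensorμ Y p.env Y' p'.env ≫ ((β_ Y Y').hom ⊗ₘ (β_ p.env p'.env).hom) =
      (β_ _ _).hom ≫ tensorμ Y' p'.env Y p.env := by
    rw [← Category.comp_id (_ ⊗ₘ _), ← h', reassoc_of% h,
      reassoc_of% tensorμ_comp_tensorμ Y p.env Y' p'.env]
  simp only [Purification.tensor, Purification.precomp, Purification.postcomp, Category.assoc]
  rw [← MonoidalCategory.tensorHom_def, h2, BraidedCategory.braiding_naturality_assoc]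

theorem discard_unit : DilationEquiv (discard (𝟙_ C)) (pure (𝟙 (𝟙_ C))) :=
  .of_map_eq (by rw [Category.id_comp, unitors_inv_equal])

theorem discard_tensor (X Y : C) : DilationEquiv (discard (X ⊗ Y))
    (((discard X).tensor (discard Y)).comp (pure (λ_ (𝟙_ C)).hom)) := by
  refine .symm ((comp_pure _ _).trans (.of_map_eq ?_))
  have h := leftUnitor_monoidal X Y
  rw [← cancel_mono (λ_ (X ⊗ Y)).hom, Category.assoc, Category.assoc, ← h,
    tensorHom_comp_tensorHom]
  simp

/-- The one generating relation whose zigzag uses an arbitrary isometry; all others use structural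
isomorphisms or identities. -/
theorem isometry_discard {X Y : C} (u : X ⟶ Y) (hu : IsIsometry u) :
    DilationEquiv ((pure u).comp (discard Y)) (discard X) :=
  (pure_comp _ _).trans (.symm (.of_isometry u hu (leftUnitor_inv_naturality u).symm))

end DilationEquiv

/-- The purification represented by a formal diagram. -/
def Diagram.purify : ∀ {X Y : C}, Diagram X Y → Purification X Y
  | _, _, .of f => .pure f
  | _, _, .disc X => .discard X
  | _, _, .comp s t => s.purify.comp t.purify
  | _, _, .tensor s t => s.purify.tensor t.purify

/-- The completeness half of the analysis of `DiscardCat C`: since equality there is generated by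
these rules, no identifications arise beyond zigzags of isometries. -/
theorem Diagram.Rel.purify {X Y : C} {s t : Diagram X Y} (h : s.Rel t) :
    DilationEquiv s.purify t.purify := by
  induction h with
  | refl s => exact .of_map_eq rfl
  | symm _ h => exact h.symm
  | trans _ _ h h' => exact h.trans h'
  | comp_congr _ _ h h' => exact h.comp_congr h'
  | tensor_congr _ _ h h' => exact h.tensor_congr h'
  | id_comp s => exact (DilationEquiv.pure_comp _ _).trans (.of_map_eq (by simp))
  | comp_id s => exact (DilationEquiv.comp_pure _ _).trans (.of_map_eq (by simp))
  | assoc r s t => exact .assoc _ _ _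
  | tensor_comp s t s' t' => exact .tensor_comp _ _ _ _
  | associator_naturality s s' s'' =>
    exact (DilationEquiv.comp_pure _ _).trans
      ((DilationEquiv.tensor_associator _ _ _).trans (DilationEquiv.pure_comp _ _).symm)
  | leftUnitor_naturality s =>
    refine (DilationEquiv.comp_congr_left (.pure_tensor _ _) _).trans
      ((DilationEquiv.comp_pure _ _).trans (.trans (.of_map_eq ?_)
        (DilationEquiv.pure_comp _ _).symm))
    simp
  | rightUnitor_naturality s =>
    refine (DilationEquiv.comp_congr_left (.tensor_pure _ _) _).trans
      ((DilationEquiv.comp_pure _ _).trans (.trans (.of_map_eq ?_)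
        (DilationEquiv.pure_comp _ _).symm))
    simp [braiding_tensorUnit_right]
  | braiding_naturality s s' =>
    exact (DilationEquiv.comp_pure _ _).trans
      ((DilationEquiv.tensor_braiding _ _).trans (DilationEquiv.pure_comp _ _).symm)
  | of_comp f g =>
    exact .symm ((DilationEquiv.pure_comp _ _).trans (.of_map_eq (by simp [Diagram.purify])))
  | of_tensor f g => exact .pure_tensor_pure _ _
  | disc_isometry u hu => exact .isometry_discard u hu
  | disc_unit => exact .discard_unit
  | disc_tensor X Y => exact .discard_tensor X Y

end Normalization

open Functor.LaxMonoidal Functor.OplaxMonoidal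

/-! ### Realizing purifications in an arbitrary extension with discard maps. -/

section DiscardMaps

variable {C : Type u} [Category.{v} C] [MonoidalCategory C] [SymmetricCategory C]
  {D : Type u'} [Category.{v'} D] [MonoidalCategory D] [SymmetricCategory D]
  (ι : C ⥤ D) [ι.Braided] (disc : ∀ X : C, ι.obj X ⟶ 𝟙_ D)

theorem map_whiskerRight_discardSnd {B B' : C} (f : B ⟶ B') (X : C) :
    ι.map (f ▷ X) ≫ discardSnd ι disc B' X = discardSnd ι disc B X ≫ ι.map f := by
  simp only [discardSnd, Category.assoc]
  rw [← δ_natural_left_assoc, ← whisker_exchange_assoc, rightUnitor_naturality]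

theorem map_whiskerLeft_discardSnd {X Y : C} (u : X ⟶ Y) (hu : ι.map u ≫ disc Y = disc X)
    (B : C) : ι.map (B ◁ u) ≫ discardSnd ι disc B Y = discardSnd ι disc B X := by
  simp only [discardSnd]
  rw [← δ_natural_right_assoc, ← whiskerLeft_comp_assoc, hu]

theorem discardSnd_unit_right (disc_unit : disc (𝟙_ C) = η ι) (B : C) :
    ι.map (ρ_ B).inv ≫ discardSnd ι disc B (𝟙_ C) = 𝟙 _ := by
  rw [discardSnd, disc_unit, Functor.Monoidal.map_rightUnitor_inv]
  simp

theorem map_leftUnitor_inv_discardSnd (X : C) :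
    ι.map (λ_ X).inv ≫ discardSnd ι disc (𝟙_ C) X = disc X ≫ ε ι := by
  rw [discardSnd, Functor.Monoidal.map_leftUnitor_inv]
  simp only [Category.assoc, Functor.Monoidal.μ_δ_assoc]
  rw [← whisker_exchange_assoc, rightUnitor_naturality, ← leftUnitor_inv_naturality_assoc,
    ← unitors_equal, Iso.inv_hom_id_assoc]

/-- Multiplicativity of the discard maps merges two successive discards into one, so realizations
are closed under composition. -/
theorem discardSnd_discardSnd (disc_tensor : ∀ A B : C, disc (A ⊗ B) =
      δ ι A B ≫ (disc A ⊗ₘ disc B) ≫ (λ_ (𝟙_ D)).hom) (B X Y : C) :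
    discardSnd ι disc (B ⊗ X) Y ≫ discardSnd ι disc B X =
      ι.map (α_ B X Y).hom ≫ discardSnd ι disc B (X ⊗ Y) := by
  have h : ∀ {P Q R : D} (m : Q ⟶ 𝟙_ D) (n : R ⟶ 𝟙_ D),
      (P ⊗ Q) ◁ n ≫ (ρ_ _).hom ≫ P ◁ m ≫ (ρ_ P).hom =
        (α_ _ _ _).hom ≫ P ◁ ((m ⊗ₘ n) ≫ (λ_ (𝟙_ D)).hom) ≫ (ρ_ P).hom := by
    intro P Q R m n
    rw [tensorHom_def']
    monoidal
  rw [discardSnd, discardSnd, discardSnd, disc_tensor, Functor.Monoidal.map_associator,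
    whiskerLeft_comp (W := ι.obj B) (δ ι X Y)]
  simp only [Category.assoc, Functor.Monoidal.μ_δ_assoc, Functor.Monoidal.whiskerLeft_μ_δ_assoc]
  rw [← rightUnitor_naturality_assoc, whisker_exchange_assoc, h]

theorem whiskerLeft_discardSnd (Z B X : C) :
    δ ι Z (B ⊗ X) ≫ ι.obj Z ◁ discardSnd ι disc B X ≫ μ ι Z B =
      ι.map (α_ Z B X).inv ≫ discardSnd ι disc (Z ⊗ B) X := by
  have h : ∀ {P Q R : D} (n : R ⟶ 𝟙_ D), P ◁ Q ◁ n ≫ P ◁ (ρ_ Q).hom =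
      (α_ _ _ _).inv ≫ (P ⊗ Q) ◁ n ≫ (ρ_ (P ⊗ Q)).hom := by
    intro P Q R n
    monoidal
  rw [discardSnd, discardSnd, Functor.Monoidal.map_associator_inv]
  simp only [Category.assoc, Functor.Monoidal.μ_δ_assoc, whiskerLeft_comp]
  rw [reassoc_of% h, ← whisker_exchange_assoc, rightUnitor_naturality]

/-- The morphism obtained from `f : A ⟶ B ⊗ X` by discarding `X`. -/
def Purification.realize {A B : C} (p : Purification A B) : ι.obj A ⟶ ι.obj B :=
  ι.map p.map ≫ discardSnd ι disc B p.env

open Purification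

variable {disc}

theorem realize_comp (disc_tensor : ∀ A B : C, disc (A ⊗ B) =
      δ ι A B ≫ (disc A ⊗ₘ disc B) ≫ (λ_ (𝟙_ D)).hom) {X Y Z : C} (p : Purification X Y)
    (q : Purification Y Z) :
    (p.comp q).realize ι disc = p.realize ι disc ≫ q.realize ι disc := by
  simp only [realize, Purification.comp, Functor.map_comp, Category.assoc]
  rw [← discardSnd_discardSnd ι disc disc_tensor,
    reassoc_of% map_whiskerRight_discardSnd ι disc]

theorem realize_pure (disc_unit : disc (𝟙_ C) = η ι) {X Y : C} (f : X ⟶ Y) :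
    (pure f).realize ι disc = ι.map f := by
  simp only [realize, Purification.pure, Functor.map_comp, Category.assoc]
  rw [discardSnd_unit_right ι disc disc_unit, Category.comp_id]

theorem realize_whiskerLeft (Z : C) {A B : C} (p : Purification A B) :
    realize ι disc ⟨p.env, Z ◁ p.map ≫ (α_ Z B p.env).inv⟩ =
      δ ι Z A ≫ ι.obj Z ◁ p.realize ι disc ≫ μ ι Z B := by
  simp only [realize, Functor.map_comp, Category.assoc, whiskerLeft_comp]
  rw [← whiskerLeft_discardSnd, ← δ_natural_right_assoc]

end DiscardMaps

/-! ### Transport of duals along monoidal functors. -/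

section Compact

variable {C : Type u} [Category.{v} C] [MonoidalCategory C]
  {D : Type u'} [Category.{v'} D] [MonoidalCategory D]

/-- Monoidal functors preserve exact pairings. -/
abbrev exactPairingMap (F : C ⥤ D) [F.Monoidal] (X Y : C) [ExactPairing X Y] :
    ExactPairing (F.obj X) (F.obj Y) where
  coevaluation' := ε F ≫ F.map (η_ X Y) ≫ δ F X Y
  evaluation' := μ F Y X ≫ F.map (ε_ X Y) ≫ η F
  coevaluation_evaluation' := by
    have h := congrArg F.map (ExactPairing.coevaluation_evaluation X Y)
    simp only [Functor.map_comp, Functor.Monoidal.map_whiskerLeft,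
      Functor.Monoidal.map_whiskerRight, Functor.Monoidal.map_associator_inv,
      Functor.Monoidal.map_rightUnitor, Functor.Monoidal.map_leftUnitor_inv, Category.assoc,
      Functor.Monoidal.μ_δ_assoc] at h
    -- The structure maps of `F` are invertible, so composing with them at both ends turns the goal
    -- into the image of the snake equation.
    rw [← cancel_epi (F.obj Y ◁ η F), ← cancel_epi (δ F Y (𝟙_ C)),
      ← cancel_mono (ε F ▷ F.obj Y), ← cancel_mono (μ F (𝟙_ C) Y)]
    simpa [← whiskerLeft_comp_assoc, ← comp_whiskerRight_assoc, -whiskerLeft_comp,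
      -comp_whiskerRight, -μ_natural_left, -μ_natural_right] using h
  evaluation_coevaluation' := by
    have h := congrArg F.map (ExactPairing.evaluation_coevaluation X Y)
    simp only [Functor.map_comp, Functor.Monoidal.map_whiskerLeft,
      Functor.Monoidal.map_whiskerRight, Functor.Monoidal.map_associator,
      Functor.Monoidal.map_leftUnitor, Functor.Monoidal.map_rightUnitor_inv, Category.assoc,
      Functor.Monoidal.μ_δ_assoc] at h
    rw [← cancel_epi (η F ▷ F.obj X), ← cancel_epi (δ F (𝟙_ C) X),
      ← cancel_mono (F.obj X ◁ ε F), ← cancel_mono (μ F X (𝟙_ C))]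
    simpa [← whiskerLeft_comp_assoc, ← comp_whiskerRight_assoc, -whiskerLeft_comp,
      -comp_whiskerRight, -μ_natural_left, -μ_natural_right] using h

end Compact

/-! ### Equality of morphisms in the discard construction, and the first equivalence. -/

section Discard

variable {C : Type u} [Category.{v} C] [MonoidalCategory C] [SymmetricCategory C] [DaggerSMC C]

open Purification

theorem realize_eq_of_dilationEquiv {D : Type u'} [Category.{v'} D] [MonoidalCategory D]
    [SymmetricCategory D] (ι : C ⥤ D) [ι.Braided] {disc : ∀ X : C, ι.obj X ⟶ 𝟙_ D}
    (hdisc : ∀ {X Y : C} (u : X ⟶ Y), IsIsometry u → ι.map u ≫ disc Y = disc X)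
    {A B : C} {p q : Purification A B} (h : DilationEquiv p q) :
    p.realize ι disc = q.realize ι disc := by
  have key : ∀ {p q : Purification A B}, IsoRel p q → p.realize ι disc = q.realize ι disc := by
    rintro p q ⟨Z, u, v, hu, hv, h⟩
    rw [realize, realize, ← map_whiskerLeft_discardSnd ι disc u (hdisc u hu),
      ← map_whiskerLeft_discardSnd ι disc v (hdisc v hv), ← ι.map_comp_assoc, h,
      ι.map_comp_assoc]
  induction h with
  | single h => exact key h
  | tail _ h ih => exact ih.trans (key h)

namespace DiscardCat

theorem disc_unit : disc C (𝟙_ C) = η (incl C) := homMk_eq .disc_unit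

theorem disc_tensor (A B : C) : disc C (A ⊗ B) =
    δ (incl C) A B ≫ (disc C A ⊗ₘ disc C B) ≫ (λ_ (𝟙_ (DiscardCat C))).hom :=
  (homMk_eq (.disc_tensor A B)).trans (Category.id_comp _).symm

theorem map_comp_disc {X Y : C} (u : X ⟶ Y) (hu : IsIsometry u) :
    (incl C).map u ≫ disc C Y = disc C X := homMk_eq (.disc_isometry u hu)

/-- Exhibits an explicit representing diagram, to which `Diagram.Rel.purify` can be applied; the
structure map of `incl C` is an identity and drops out. -/
theorem realize_eq_homMk {A B : C} (p : Purification A B) : p.realize (incl C) (disc C) =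
    homMk (.comp (.of p.map) (.comp (.tensor (.of (𝟙 B)) (.disc p.env)) (.of (ρ_ B).hom))) :=
  congrArg ((incl C).map p.map ≫ ·) (Category.id_comp _)

theorem exists_realize {A B : C} (f : (mk A : DiscardCat C) ⟶ mk B) :
    ∃ p : Purification A B, p.realize (incl C) (disc C) = f := by
  have tensor_left : ∀ {X Y : C} (Z : C) {f : (mk X : DiscardCat C) ⟶ mk Y},
      (∃ p : Purification X Y, p.realize (incl C) (disc C) = f) →
      ∃ p : Purification (Z ⊗ X) (Z ⊗ Y), p.realize (incl C) (disc C) =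
        (mk Z : DiscardCat C) ◁ f := by
    rintro X Y Z _ ⟨p, rfl⟩
    exact ⟨_, (realize_whiskerLeft (incl C) Z p).trans
      ((Category.id_comp _).trans (Category.comp_id _))⟩
  have comp : ∀ {X Y Z : C} {f : (mk X : DiscardCat C) ⟶ mk Y} {g : (mk Y : DiscardCat C) ⟶ mk Z},
      (∃ p : Purification X Y, p.realize (incl C) (disc C) = f) →
      (∃ p : Purification Y Z, p.realize (incl C) (disc C) = g) →
      ∃ p : Purification X Z, p.realize (incl C) (disc C) = f ≫ g := by
    rintro X Y Z _ _ ⟨p, rfl⟩ ⟨q, rfl⟩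
    exact ⟨_, realize_comp (incl C) disc_tensor p q⟩
  have of : ∀ {X Y : C} (f : X ⟶ Y),
      ∃ p : Purification X Y, p.realize (incl C) (disc C) = (incl C).map f :=
    fun f => ⟨_, realize_pure (incl C) disc_unit f⟩
  obtain ⟨s, rfl⟩ : ∃ s : Diagram A B, homMk s = f := homMk_surjective f
  induction s with
  | of f => exact of f
  | disc X =>
    exact ⟨discard X, (map_leftUnitor_inv_discardSnd (incl C) (disc C) X).trans
      (Category.comp_id _)⟩
  | comp s t hs ht => exact comp (hs) (ht)
  | @tensor X Y X' Y' s t hs ht =>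
    -- Conjugating by braidings turns whiskering on the right into whiskering on the left, so
    -- closure under the latter suffices.
    have h : homMk (.tensor s t) = ((β_ (mk X : DiscardCat C) (mk X')).hom ≫
        (mk X' : DiscardCat C) ◁ homMk s ≫ (β_ (mk X' : DiscardCat C) (mk Y)).hom) ≫
          (mk Y : DiscardCat C) ◁ homMk t := by
      rw [homMk_tensor, MonoidalCategory.tensorHom_def,
        BraidedCategory.braiding_naturality_right, SymmetricCategory.symmetry_assoc]
    rw [h]
    exact comp (comp (of _) (comp (tensor_left X' hs) (of _))) (tensor_left Y ht)

/-- Purifying the representing diagram of `p` returns `p` up to trivial factors of the environment.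
-/
theorem purify_dilationEquiv {A B : C} (p : Purification A B) :
    DilationEquiv (Diagram.purify (.comp (.of p.map)
      (.comp (.tensor (.of (𝟙 B)) (.disc p.env)) (.of (ρ_ B).hom)))) p := by
  refine (DilationEquiv.comp_congr_right _ ((DilationEquiv.comp_congr_left
    (.pure_tensor B (discard p.env)) _).trans (.comp_pure _ _))).trans
      ((DilationEquiv.pure_comp _ _).trans (.of_map_eq ?_))
  simp

theorem realize_eq_iff {A B : C} (p q : Purification A B) :
    p.realize (incl C) (disc C) = q.realize (incl C) (disc C) ↔ DilationEquiv p q := by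
  refine ⟨fun h => ?_, realize_eq_of_dilationEquiv (incl C) map_comp_disc⟩
  rw [realize_eq_homMk, realize_eq_homMk] at h
  exact (purify_dilationEquiv p).symm.trans
    ((Diagram.Rel.purify (Quotient.exact h)).trans (purify_dilationEquiv q))

theorem isCompactClosed (h : IsCompactClosed C) : IsCompactClosed (DiscardCat C) := fun X => by
  obtain ⟨X', ⟨_⟩⟩ := h X.obj
  exact ⟨⟨X'⟩, ⟨exactPairingMap (incl C) X' X.obj⟩⟩

theorem isIdentityOnObjects : IsIdentityOnObjects (incl C) where
  bijective := ⟨fun _ _ h => congrArg DiscardCat.obj h, fun X => ⟨X.obj, rfl⟩⟩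
  unit := ⟨rfl, rfl⟩
  tensor _ _ := ⟨rfl, rfl⟩

/-- Only the uniqueness axiom depends on having enough isometries; `realize_eq_iff` rewrites its
right-hand side as `∼_iso⁺`. -/
theorem enoughIsometries_iff :
    EnoughIsometries C ↔ IsEnvironmentStructure (incl C) (disc C) := by
  refine ⟨fun h => ⟨isCompactClosed, isIdentityOnObjects, disc_unit, disc_tensor, fun f => ?_,
    fun p q => (h _ _ p q).trans (realize_eq_iff p q).symm⟩,
    fun h _ _ p q => (h.uniqueness p q).trans (realize_eq_iff p q)⟩
  obtain ⟨p, hp⟩ := exists_realize f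
  exact ⟨p, hp.symm⟩

end DiscardCat

end Discard

/-! ### Wire bending in a symmetric monoidal category. -/

section Bending

variable {C : Type u} [Category.{v} C] [MonoidalCategory C] [SymmetricCategory C]

/-- By naturality of the braiding, a wire crosses the whole of `c` trivially, so crossing one leg
amounts to crossing the other. -/
theorem braiding_slide {A' B B' : C} (c : B ⊗ B' ⟶ 𝟙_ C) :
    B ◁ (β_ A' B').hom ≫ (α_ _ _ _).inv ≫ c ▷ A' ≫ (λ_ A').hom =
      (α_ _ _ _).inv ≫ (β_ B A').hom ▷ B' ≫ (α_ _ _ _).hom ≫ A' ◁ c ≫ (ρ_ A').hom := by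
  have h := BraidedCategory.braiding_naturality_right A' c
  rw [← braiding_leftUnitor A', reassoc_of% h, BraidedCategory.braiding_tensor_right_hom]
  simp only [Category.assoc, Iso.hom_inv_id_assoc, ← comp_whiskerRight_assoc,
    SymmetricCategory.symmetry, id_whiskerRight, Category.id_comp, Iso.inv_hom_id_assoc]

/-- The diagrammatic core of `bend_doubled`, with the cups of `B` and `X` replaced by arbitrary
pairings `c` and `d`; no snake equation is needed. -/
theorem contract_braiding {B B' X X' : C} (c : B ⊗ B' ⟶ 𝟙_ C) (d : X ⊗ X' ⟶ 𝟙_ C) :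
    B ◁ (tensorμ B X B' X' ≫ (B ⊗ B') ◁ d ≫ (ρ_ _).hom ≫ (β_ B B').hom) ≫
        (α_ B B' B).inv ≫ c ▷ B ≫ (λ_ B).hom =
      (α_ B (B ⊗ X) (B' ⊗ X')).inv ≫
        ((β_ B (B ⊗ X)).hom ≫ (α_ B X B).hom ≫ B ◁ (β_ X B).hom) ▷ (B' ⊗ X') ≫
          (α_ B (B ⊗ X) (B' ⊗ X')).hom ≫
            B ◁ (tensorμ B X B' X' ≫ (c ⊗ₘ d) ≫ (λ_ _).hom) ≫ (ρ_ B).hom := by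
  -- The incoming `B` crosses `X` and then crosses back, so only the crossing of the two `B`-wires
  -- survives.
  have h : (β_ B (B ⊗ X)).hom ≫ (α_ B X B).hom ≫ B ◁ (β_ X B).hom =
      (α_ B B X).inv ≫ (β_ B B).hom ▷ X ≫ (α_ B B X).hom := by
    rw [BraidedCategory.braiding_tensor_right_hom]
    simp [← whiskerLeft_comp]
  rw [h]
  -- `braiding_slide` replaces the crossing of `B` with `B'` by one of `B` with `B`. This then moves
  -- ahead of `d` and of the crossing of `X` with `B'`, which involve other wires.
  calc _ = B ◁ (tensorμ B X B' X' ≫ (B ⊗ B') ◁ d ≫ (ρ_ _).hom) ≫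
        (B ◁ (β_ B B').hom ≫ (α_ B B' B).inv ≫ c ▷ B ≫ (λ_ B).hom) := by simp
    _ = 𝟙 _ ⊗≫ (B ⊗ B) ◁ (β_ X B').hom ▷ X' ⊗≫ ((B ⊗ B) ⊗ B') ◁ d ⊗≫
        (β_ B B).hom ▷ B' ⊗≫ B ◁ c ⊗≫ 𝟙 _ := by
      rw [braiding_slide, tensorμ]; monoidal
    _ = 𝟙 _ ⊗≫ (B ⊗ B) ◁ (β_ X B').hom ▷ X' ⊗≫
        ((B ⊗ B) ◁ (B' ◁ d) ≫ (β_ B B).hom ▷ (B' ⊗ 𝟙_ C)) ⊗≫ B ◁ c ⊗≫ 𝟙 _ := by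
      monoidal
    _ = 𝟙 _ ⊗≫ ((B ⊗ B) ◁ ((β_ X B').hom ▷ X') ≫ (β_ B B).hom ▷ ((B' ⊗ X) ⊗ X')) ⊗≫
        B ◁ (c ⊗ₘ d) ⊗≫ 𝟙 _ := by
      rw [whisker_exchange, tensorHom_def']; monoidal
    _ = _ := by
      rw [whisker_exchange, tensorμ]; monoidal

end Bending

/-! ### Equality of morphisms in `CPM C` is `∼_CP`. -/

section CPM

variable {C : Type u} [Category.{v} C] [MonoidalCategory C] [SymmetricCategory C] [DaggerSMC C]
  [DaggerCompact C]

open Discarding.DaggerCompact (dual)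

theorem double_δ (A B : C) : δ (double C) A B =
    (A ⊗ B) ◁ (dualTensor A B).inv ≫ tensorμ A B (dual A) (dual B) := by
  have h : (tensorμ A (dual A) B (dual B) ≫ (A ⊗ B) ◁ (dualTensor A B).hom) ≫
      (A ⊗ B) ◁ (dualTensor A B).inv ≫ tensorμ A B (dual A) (dual B) = 𝟙 _ := by
    rw [Category.assoc, whiskerLeft_hom_inv_assoc, tensorμ_comp_tensorμ]
  exact (cancel_epi (μ (double C) A B)).1 ((Functor.Monoidal.μ_δ _ _ _).trans
    ((congrArg (· ≫ _) (double_μ A B)).trans h).symm)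

theorem doubled_eq {A B : C} (p : Purification A B) : p.doubled =
    (p.map ⊗ₘ (conj p.map ≫ (dualTensor B p.env).inv)) ≫ tensorμ B p.env (dual B) (dual p.env) ≫
      (B ⊗ dual B) ◁ cup p.env ≫ (ρ_ (B ⊗ dual B)).hom := by
  rw [Purification.doubled, discardSnd, double_map, double_δ, ← Category.comp_id p.map,
    ← tensorHom_comp_tensorHom, id_tensorHom]
  simp only [Category.assoc, Category.comp_id]
  exact congrArg ((p.map ⊗ₘ conj p.map) ≫ ·) (Category.assoc _ _ _)

theorem conj_cup₂ {A B X : C} (f : A ⟶ B ⊗ X) :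
    (B ⊗ X) ◁ (conj f ≫ (dualTensor B X).inv) ≫ cup₂ B X = f† ▷ dual A ≫ cup A := by
  rw [← dualTensor_cup, ← whiskerLeft_comp_assoc, Category.assoc, Iso.inv_hom_id,
    Category.comp_id, conj_cup]

/-- On the left the output `B*` is bent to an input `B`; on the right the output `A` of `p.plug` is
bent to an input `A*`. Sliding `p.map†` around the cup of `A` turns it into the conjugate occurring
in the doubling. -/
theorem bend_doubled {A B : C} (p : Purification A B) :
    (tensorLeftHomEquiv (A ⊗ dual A) (dual B) B B).symm (p.doubled ≫ (β_ B (dual B)).hom) =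
      (α_ B A (dual A)).inv ≫
        (tensorRightHomEquiv (B ⊗ A) (dual A) A B).symm ((β_ B A).hom ≫ p.plug) := by
  change B ◁ (p.doubled ≫ (β_ B (dual B)).hom) ≫ (α_ _ _ _).inv ≫ cup B ▷ B ≫ (λ_ _).hom =
    (α_ B A (dual A)).inv ≫ ((β_ B A).hom ≫ p.plug) ▷ dual A ≫ (α_ _ _ _).hom ≫
      B ◁ cup A ≫ (ρ_ _).hom
  have h := contract_braiding (cup B) (cup p.env)
  have hp : ((β_ B A).hom ≫ p.plug) ▷ dual A ≫ (α_ _ _ _).hom ≫ B ◁ cup A ≫ (ρ_ _).hom =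
      (α_ B A (dual A)).hom ≫ B ◁ (p.map ⊗ₘ (conj p.map ≫ (dualTensor B p.env).inv)) ≫
      (α_ B (B ⊗ p.env) (dual B ⊗ dual p.env)).inv ≫
        ((β_ B (B ⊗ p.env)).hom ≫ (α_ B p.env B).hom ≫ B ◁ (β_ p.env B).hom) ▷
          (dual B ⊗ dual p.env) ≫ (α_ B (B ⊗ p.env) _).hom ≫ B ◁ cup₂ B p.env ≫ (ρ_ B).hom := by
    have h1 : (β_ B A).hom ≫ p.plug = B ◁ p.map ≫ ((β_ B (B ⊗ p.env)).hom ≫ (α_ B p.env B).hom ≫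
        B ◁ (β_ p.env B).hom) ≫ B ◁ p.map† := by
      rw [Purification.plug, ← BraidedCategory.braiding_naturality_right_assoc]
      simp only [Category.assoc]
    rw [h1]
    generalize ((β_ B (B ⊗ p.env)).hom ≫ (α_ B p.env B).hom ≫ B ◁ (β_ p.env B).hom) = b
    have h2 : (B ◁ p.map†) ▷ dual A ≫ (α_ B A (dual A)).hom ≫ B ◁ cup A =
        (B ⊗ (B ⊗ p.env)) ◁ (conj p.map ≫ (dualTensor B p.env).inv) ≫ (α_ _ _ _).hom ≫
          B ◁ cup₂ B p.env := by
      rw [associator_naturality_middle_assoc, ← whiskerLeft_comp, ← conj_cup₂]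
      monoidal
    simp only [comp_whiskerRight, Category.assoc]
    rw [reassoc_of% h2, ← whisker_exchange_assoc, MonoidalCategory.tensorHom_def]
    monoidal
  rw [hp, Iso.inv_hom_id_assoc, cup₂, ← h]
  refine (congrArg (fun d : A ⊗ dual A ⟶ B ⊗ dual B => B ◁ (d ≫ (β_ B (dual B)).hom) ≫
    (α_ _ _ _).inv ≫ cup B ▷ B ≫ (λ_ _).hom) (doubled_eq p)).trans ?_
  simp only [Category.assoc, whiskerLeft_comp]

/-- Bending wires is a bijection on morphisms and braidings are invertible, so by `bend_doubled`
either side determines the other. -/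
theorem cpRel_iff {A B : C} (p q : Purification A B) : CPRel p q ↔ p.doubled = q.doubled := by
  have h : ∀ d e : A ⊗ dual A ⟶ B ⊗ dual B,
      d ≫ (β_ B (dual B)).hom = e ≫ (β_ B (dual B)).hom ↔ d = e := fun _ _ => cancel_mono _
  rw [CPRel, ← cancel_epi (β_ B A).hom,
    ← (tensorRightHomEquiv (B ⊗ A) (dual A) A B).symm.injective.eq_iff,
    ← cancel_epi (α_ B A (dual A)).inv, ← bend_doubled, ← bend_doubled, Equiv.apply_eq_iff_eq]
  exact h _ _

namespace CPM

theorem disc_unit : disc C (𝟙_ C) = η (incl C) :=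
  hom_ext ((congrArg (· ≫ ε (double C)) trace_unit).trans (Functor.Monoidal.η_ε (double C)))

theorem disc_tensor (A B : C) : disc C (A ⊗ B) =
    δ (incl C) A B ≫ (disc C A ⊗ₘ disc C B) ≫ (λ_ (𝟙_ (CPM C))).hom := by
  refine Eq.trans (hom_ext ?_) (Category.id_comp _).symm
  change trace (A ⊗ B) ≫ ε (double C) = (δ (double C) A B ≫
    ((trace A ≫ ε (double C)) ⊗ₘ (trace B ≫ ε (double C))) ≫ μ (double C) (𝟙_ C) (𝟙_ C)) ≫
      (double C).map (λ_ (𝟙_ C)).hom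
  rw [trace_tensor, Functor.Monoidal.map_leftUnitor]
  simp only [Category.assoc, Functor.Monoidal.μ_δ_assoc]
  rw [← tensorHom_comp_tensorHom, MonoidalCategory.tensorHom_def' (ε (double C))]
  simp

/-- Moving the conjugate of `u` across the cup produces `u†` right after `u`, and the two cancel. -/
theorem map_comp_disc {X Y : C} (u : X ⟶ Y) (hu : IsIsometry u) :
    (incl C).map u ≫ disc C Y = disc C X := by
  have h : (u ⊗ₘ conj u) ≫ cup Y = cup X := by
    rw [MonoidalCategory.tensorHom_def, Category.assoc, conj_cup, ← comp_whiskerRight_assoc, hu,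
      id_whiskerRight, Category.id_comp]
  exact hom_ext ((Category.assoc _ _ _).symm.trans (congrArg (· ≫ ε (double C)) h))

theorem realize_val {A B : C} (p : Purification A B) :
    (p.realize (incl C) (disc C)).val = p.doubled := by
  refine congrArg ((double C).map p.map ≫ ·) ((Category.id_comp _).trans ?_)
  change (δ (double C) B p.env ≫ (double C).obj B ◁ (trace p.env ≫ ε (double C)) ≫
    μ (double C) B (𝟙_ C)) ≫ (double C).map (ρ_ B).hom = _
  rw [Functor.Monoidal.map_rightUnitor, discardSnd]
  simp

theorem exists_realize {A B : C} (f : (incl C).obj A ⟶ (incl C).obj B) :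
    ∃ p : Purification A B, p.realize (incl C) (disc C) = f := by
  obtain ⟨p, hp⟩ := f.property
  exact ⟨p, hom_ext ((realize_val p).trans hp)⟩

theorem realize_eq_iff {A B : C} (p q : Purification A B) :
    p.realize (incl C) (disc C) = q.realize (incl C) (disc C) ↔ CPRel p q := by
  rw [cpRel_iff, ← realize_val, ← realize_val]
  exact ⟨congrArg _, hom_ext⟩

end CPM

end CPM

/-! ### The functor from the discard construction to `CPM C`, and transport of realizations. -/

section Comparison

variable {C : Type u} [Category.{v} C] [MonoidalCategory C] [SymmetricCategory C] [DaggerSMC C]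
  [DaggerCompact C]

/-- The interpretation of a formal diagram in `CPM(C)`. -/
def Diagram.toCPM : ∀ {X Y : C}, Diagram X Y → ((CPM.incl C).obj X ⟶ (CPM.incl C).obj Y)
  | _, _, .of f => (CPM.incl C).map f
  | _, _, .disc X => CPM.disc C X
  | _, _, .comp s t => s.toCPM ≫ t.toCPM
  | _, _, .tensor s t => s.toCPM ⊗ₘ t.toCPM

theorem CPM.map_tensor {X Y X' Y' : C} (f : X ⟶ Y) (g : X' ⟶ Y') :
    (CPM.incl C).map (f ⊗ₘ g) = (CPM.incl C).map f ⊗ₘ (CPM.incl C).map g := by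
  rw [MonoidalCategory.tensorHom_def, Functor.map_comp, CPM.map_whiskerRight, CPM.map_whiskerLeft]
  exact (MonoidalCategory.tensorHom_def _ _).symm

theorem Diagram.Rel.toCPM_eq {X Y : C} {s t : Diagram X Y} (h : s.Rel t) : s.toCPM = t.toCPM := by
  induction h with
  | refl s => rfl
  | symm _ h => exact h.symm
  | trans _ _ h h' => exact h.trans h'
  | comp_congr _ _ h h' => exact congrArg₂ (· ≫ ·) h h'
  | tensor_congr _ _ h h' => exact congrArg₂ (· ⊗ₘ ·) h h'
  | id_comp s => exact (congrArg (· ≫ s.toCPM) ((CPM.incl C).map_id _)).trans (Category.id_comp _)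
  | comp_id s => exact (congrArg (s.toCPM ≫ ·) ((CPM.incl C).map_id _)).trans (Category.comp_id _)
  | assoc r s t => exact Category.assoc _ _ _
  | tensor_comp s t s' t' => exact tensorHom_comp_tensorHom _ _ _ _
  | associator_naturality s s' s'' => exact MonoidalCategory.associator_naturality _ _ _
  | leftUnitor_naturality s =>
    refine Eq.trans ?_ (MonoidalCategory.leftUnitor_naturality s.toCPM)
    rw [← id_tensorHom]
    exact congrArg (fun k => (k ⊗ₘ s.toCPM) ≫ (λ_ _).hom) ((CPM.incl C).map_id _)
  | rightUnitor_naturality s =>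
    refine Eq.trans ?_ (MonoidalCategory.rightUnitor_naturality s.toCPM)
    rw [← tensorHom_id]
    exact congrArg (fun k => (s.toCPM ⊗ₘ k) ≫ (ρ_ _).hom) ((CPM.incl C).map_id _)
  | braiding_naturality s s' => exact BraidedCategory.braiding_naturality _ _
  | of_comp f g => exact (CPM.incl C).map_comp f g
  | of_tensor f g => exact CPM.map_tensor f g
  | disc_isometry u hu => exact CPM.map_comp_disc u hu
  | disc_unit => exact CPM.disc_unit.trans ((CPM.incl C).map_id _).symm
  | disc_tensor X Y => exact (CPM.disc_tensor X Y).trans (Category.id_comp _)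

namespace DiscardCat

variable (C) in
/-- The comparison functor from the discard construction to the CPM construction. -/
def toCPM : DiscardCat C ⥤ CPM C where
  obj X := ⟨X.obj⟩
  map f := Quotient.lift Diagram.toCPM (fun _ _ h => Diagram.Rel.toCPM_eq h) f
  map_id X := (CPM.incl C).map_id X.obj
  map_comp f g := by
    obtain ⟨_, rfl⟩ := homMk_surjective f
    obtain ⟨_, rfl⟩ := homMk_surjective g
    rfl

theorem toCPM_map_tensor {X Y X' Y' : DiscardCat C} (f : X ⟶ Y) (g : X' ⟶ Y') :
    (toCPM C).map (f ⊗ₘ g) = (toCPM C).map f ⊗ₘ (toCPM C).map g := by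
  obtain ⟨_, rfl⟩ := homMk_surjective f
  obtain ⟨_, rfl⟩ := homMk_surjective g
  rfl

theorem toCPM_map_whiskerLeft (X : DiscardCat C) {Y Z : DiscardCat C} (f : Y ⟶ Z) :
    (toCPM C).map (X ◁ f) = (toCPM C).obj X ◁ (toCPM C).map f := by
  rw [← id_tensorHom, toCPM_map_tensor, CategoryTheory.Functor.map_id]
  exact id_tensorHom _ _

theorem toCPM_map_whiskerRight {Y Z : DiscardCat C} (f : Y ⟶ Z) (X : DiscardCat C) :
    (toCPM C).map (f ▷ X) = (toCPM C).map f ▷ (toCPM C).obj X := by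
  rw [← tensorHom_id, toCPM_map_tensor, CategoryTheory.Functor.map_id]
  exact tensorHom_id _ _

instance : (toCPM C).Monoidal :=
  Functor.CoreMonoidal.toMonoidal
    { εIso := Iso.refl _
      μIso := fun _ _ => Iso.refl _
      μIso_hom_natural_left := fun f X => by
        rw [toCPM_map_whiskerRight]; exact (Category.comp_id _).trans (Category.id_comp _).symm
      μIso_hom_natural_right := fun X f => by
        rw [toCPM_map_whiskerLeft]; exact (Category.comp_id _).trans (Category.id_comp _).symm
      associativity := fun X Y Z => by
        simp only [Iso.refl_hom]
        erw [id_whiskerRight, whiskerLeft_id, Category.id_comp, Category.id_comp, Category.comp_id,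
          Category.comp_id]
        rfl
      left_unitality := fun X => by
        simp only [Iso.refl_hom]
        erw [id_whiskerRight, Category.id_comp, Category.id_comp]
        rfl
      right_unitality := fun X => by
        simp only [Iso.refl_hom]
        erw [whiskerLeft_id, Category.id_comp, Category.id_comp]
        rfl }

instance : (toCPM C).Braided where
  braided _ _ := (Category.id_comp _).trans (Category.comp_id _).symm

end DiscardCat

/-- A realization is built from `ι`, the discards and the tensor structure, all of which `F`
preserves up to `θ`. -/
theorem map_realize_eq {D : Type u'} [Category.{v'} D] [MonoidalCategory D]
    [SymmetricCategory D] {D' : Type u''} [Category.{v''} D'] [MonoidalCategory D']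
    [SymmetricCategory D'] {C : Type u} [Category.{v} C] [MonoidalCategory C]
    [SymmetricCategory C] {ι : C ⥤ D} [ι.Braided] {disc : ∀ X : C, ι.obj X ⟶ 𝟙_ D} {ι' : C ⥤ D'}
    [ι'.Braided] {disc' : ∀ X : C, ι'.obj X ⟶ 𝟙_ D'} (F : D ⥤ D') [F.Braided]
    (θ : ι ⋙ F ≅ ι') [NatTrans.IsMonoidal θ.hom]
    (h : ∀ A : C, F.map (disc A) ≫ η F = θ.hom.app A ≫ disc' A) {A B : C}
    (p : Purification A B) :
    F.map (p.realize ι disc) ≫ θ.hom.app B = θ.hom.app A ≫ p.realize ι' disc' := by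
  have h1 : F.map (ι.map p.map) ≫ θ.hom.app (B ⊗ p.env) = θ.hom.app A ≫ ι'.map p.map :=
    θ.hom.naturality p.map
  have h2 := NatTrans.IsMonoidal.tensor (τ := θ.hom) B p.env
  -- Monoidality of `θ` restated for the inverse structure maps, since `discardSnd` is defined with
  -- `δ`.
  have h3 : δ (ι ⋙ F) B p.env ≫ (θ.hom.app B ⊗ₘ θ.hom.app p.env) =
      θ.hom.app (B ⊗ p.env) ≫ δ ι' B p.env := by
    rw [← cancel_mono (μ ι' B p.env), Category.assoc, Category.assoc, ← h2]
    simp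
  have h4 : F.map (discardSnd ι disc B p.env) ≫ θ.hom.app B =
      θ.hom.app (B ⊗ p.env) ≫ discardSnd ι' disc' B p.env := by
    simp only [discardSnd, Functor.map_comp, Functor.Monoidal.map_whiskerLeft,
      Functor.Monoidal.map_rightUnitor]
    rw [← reassoc_of% h3, ← id_tensorHom (ι'.obj B), tensorHom_comp_tensorHom_assoc,
      Category.comp_id, ← h, comp_δ, MonoidalCategory.tensorHom_def' (θ.hom.app B)]
    simp
  simp only [Purification.realize, Functor.map_comp, Category.assoc]
  rw [h4, reassoc_of% h1]

end Comparison

/-! ### The equivalence with `CPM C`. -/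

section Main

variable {C : Type u} [Category.{v} C] [MonoidalCategory C] [SymmetricCategory C] [DaggerSMC C]
  [DaggerCompact C]

theorem equivalentOver_of_enoughIsometries (h : EnoughIsometries C) :
    EquivalentOver (DiscardCat.incl C) (DiscardCat.disc C) (CPM.incl C) (CPM.disc C) := by
  let θ : DiscardCat.incl C ⋙ DiscardCat.toCPM C ≅ CPM.incl C := Iso.refl _
  have hθ : NatTrans.IsMonoidal θ.hom :=
    { unit := (Category.comp_id _).trans ((Category.id_comp _).trans
        ((DiscardCat.toCPM C).map_id _))
      tensor := fun X Y => by
        refine (Category.comp_id _).trans (Eq.trans ((Category.id_comp _).trans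
          ((DiscardCat.toCPM C).map_id _)) ?_)
        exact ((Category.comp_id _).trans (id_tensorHom_id _ _)).symm }
  have hdisc : ∀ A : C, (DiscardCat.toCPM C).map (DiscardCat.disc C A) ≫
      η (DiscardCat.toCPM C) = θ.hom.app A ≫ CPM.disc C A := fun A => by
    refine (Category.comp_id _).trans (Eq.trans ?_ (Category.id_comp _).symm)
    rfl
  have hmap : ∀ {A B : C} (p : Purification A B), (DiscardCat.toCPM C).map
      (p.realize (DiscardCat.incl C) (DiscardCat.disc C)) =
        p.realize (CPM.incl C) (CPM.disc C) := fun p =>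
    (Category.comp_id _).symm.trans ((map_realize_eq _ θ hdisc p).trans (Category.id_comp _))
  -- The only use of `h`, in the direction from `∼_CP` to `∼_iso⁺`; fullness and essential
  -- surjectivity are unconditional.
  have : (DiscardCat.toCPM C).Faithful := ⟨fun {X Y} f g hfg => by
    obtain ⟨p, rfl⟩ := DiscardCat.exists_realize f
    obtain ⟨q, rfl⟩ := DiscardCat.exists_realize g
    have hpq : p.realize (CPM.incl C) (CPM.disc C) = q.realize (CPM.incl C) (CPM.disc C) :=
      (hmap p).symm.trans (hfg.trans (hmap q))
    exact (DiscardCat.realize_eq_iff p q).2 ((h _ _ p q).1 ((CPM.realize_eq_iff p q).1 hpq))⟩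
  have : (DiscardCat.toCPM C).Full := ⟨fun f => by
    obtain ⟨p, rfl⟩ := CPM.exists_realize f
    exact ⟨_, hmap p⟩⟩
  have : (DiscardCat.toCPM C).EssSurj := ⟨fun Y => ⟨⟨Y.obj⟩, ⟨Iso.refl _⟩⟩⟩
  have : (DiscardCat.toCPM C).IsEquivalence := {}
  exact ⟨(DiscardCat.toCPM C).asEquivalence, inferInstanceAs (DiscardCat.toCPM C).Braided, θ, hθ,
    hdisc⟩

theorem enoughIsometries_of_equivalentOver
    (h : EquivalentOver (DiscardCat.incl C) (DiscardCat.disc C) (CPM.incl C) (CPM.disc C)) :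
    EnoughIsometries C := by
  obtain ⟨E, _, θ, _, hdisc⟩ := h
  intro A B p q
  have hp := map_realize_eq E.functor θ hdisc p
  have hq := map_realize_eq E.functor θ hdisc q
  refine Iff.trans ?_ (DiscardCat.realize_eq_iff p q)
  -- The components of `θ` are invertible and cancel, after which faithfulness of `E.functor` is all
  -- that is needed.
  rw [← CPM.realize_eq_iff, ← cancel_epi (θ.hom.app A), ← hp, ← hq, cancel_mono]
  exact E.functor.map_injective_iff _ _

end Main

end Discarding

theorem mainTheorem2 {C : Type u} [Category.{v} C] [MonoidalCategory C] [SymmetricCategory C]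
    [DaggerSMC C] :
    (EnoughIsometries C ↔ IsEnvironmentStructure (DiscardCat.incl C) (DiscardCat.disc C)) ∧
    ∀ [DaggerCompact C], List.TFAE
      [EnoughIsometries C,
        IsEnvironmentStructure (DiscardCat.incl C) (DiscardCat.disc C),
        EquivalentOver (DiscardCat.incl C) (DiscardCat.disc C) (CPM.incl C) (CPM.disc C)] := by
  refine ⟨DiscardCat.enoughIsometries_iff, ?_⟩
  intro _
  tfae_have 1 ↔ 2 := DiscardCat.enoughIsometries_iff
  tfae_have 1 → 3 := equivalentOver_of_enoughIsometries
  tfae_have 3 → 1 := enoughIsometries_of_equivalentOver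
  tfae_finish
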